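/- All graphs are finite and simple. A bipartite graph $G=(A,B,E)$ is given together with a partition of its vertex set into two independent sets $A$ and $B$. It is a *chain graph* if, within each of the two parts, the neighbourhoods of the vertices form a chain with respect to inclusion. It is a *quasi-chain graph* if it contains no unbalanced induced copy of $2P_3$, i.e. no induced subgraph isomorphic to the disjoint union of two chordless paths on three vertices in which the middle vertices of both paths lie in the same part. For two graphs $G_1=(V,E_1)$ and $G_2=(V,E_2)$ on the same vertex set, $G_1\otimes G_2$ denotes the graph on $V$ whose edge set is the symmetric difference of $E_1$ and $E_2$. A *matching* is a set of edges no two of which share an endpoint. An *enhanced word* is a word $w$ over the alphabet $\{a,b\}$ together with a set of *bottom edges*, each joining a letter $a$ to a letter $b$ that appears after it in $w$, and a set of *top edges*, each joining a letter $a$ to a letter $b$ that appears before it in $w$, such that the bottom edges form a matching and the top edges form a matching. It describes the graph whose vertices are the entries of $w$, in which an $a$ and a $b$ are adjacent if and only if either the $a$ appears before the $b$ and they are not joined by a bottom edge, or they are joined by a top edge. It is an *enhanced letter representation* of $G=(A,B,E)$ if $G$ is isomorphic to the graph it describes by an isomorphism under which the vertices of $A$ correspond to the letters $a$ and the vertices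 of $B$ to the letters $b$. **Theorem.** Let $G=(A,B,E)$ be a quasi-chain graph. Then $G=Z\otimes H$ for some chain graph $Z$ with the same parts $A$ and $B$ and some graph $H$ of maximum degree at most $2$ such that $E(H)\cap E(Z)$ and $E(H)\setminus E(Z)$ are matchings. Moreover, there is an algorithm that, given a quasi-chain graph $G=(A,B,E)$ with $n$ vertices, finds such a decomposition in time polynomial in $n$; and there is an algorithm that, given such a $G$, finds an enhanced letter representation of $G$ in time polynomial in $n$. (Algorithms are programs for a random access machine with addition and truncated subtraction, where every instruction and every test takes one step; the input is $n$, the partition and the adjacency matrix.) -/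

import Mathlib

open scoped symmDiff

namespace QuasiChain

/-! ## Bipartite graphs, chain graphs, quasi-chain graphs

A bipartite graph `G = (A, B, E)` is a simple graph `G` on a vertex type `V` with a map
`c : V → Bool`, where `A` is the set of vertices `v` with `c v = true` and `B` is the set of
vertices with `c v = false`. -/

section Graphs

variable {V : Type*}

/-- Both parts of the partition of `V` given by `c` are independent sets of `G`. -/
def IsBipartition (G : SimpleGraph V) (c : V → Bool) : Prop :=
  ∀ u v, G.Adj u v → c u ≠ c v

/-- The disjoint union `2P₃` of two chordless paths on three vertices; the two centres are
`Sum.inl 1` and `Sum.inr 1`. -/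
def twoP3 : SimpleGraph (Fin 3 ⊕ Fin 3) :=
  SimpleGraph.pathGraph 3 ⊕g SimpleGraph.pathGraph 3

/-- The bipartite graph `(G, c)` is a quasi-chain graph: it has no unbalanced induced copy of
`2P₃`. An induced copy is unbalanced when its two centres lie in the same part (so that this part
contains two and the other part four of its vertices). -/
def IsQuasiChain (G : SimpleGraph V) (c : V → Bool) : Prop :=
  IsBipartition G c ∧ ¬ ∃ f : twoP3 ↪g G, c (f (Sum.inl 1)) = c (f (Sum.inr 1))

/-- The bipartite graph `(Z, c)` is a chain graph: in each part, the neighbourhoods of the vertices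
form a chain with respect to inclusion. -/
def IsChainGraph (Z : SimpleGraph V) (c : V → Bool) : Prop :=
  IsBipartition Z c ∧
    ∀ b : Bool, IsChain (· ⊆ ·) ((fun v => Z.neighborSet v) '' {v | c v = b})

/-- A set of edges is a matching: no two distinct edges in it share an endpoint. -/
def IsEdgeMatching (M : Set (Sym2 V)) : Prop :=
  M.Pairwise fun e f => ∀ v ∈ e, v ∉ f

/-- `G = Z ⊗ H` (symmetric difference) is a decomposition of the bipartite graph `(G, c)` into a
chain graph `Z` with the same parts and a graph `H` of vertex degree at most two such that
`E(H) ∩ E(Z)` and `E(H) - E(Z)` are matchings. -/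
structure IsDecomposition (G : SimpleGraph V) (c : V → Bool) (Z H : SimpleGraph V) : Prop where
  eq_symmDiff : G = Z ∆ H
  chain : IsChainGraph Z c
  degree_le : ∀ v, (H.neighborSet v).encard ≤ 2
  inter_matching : IsEdgeMatching (H.edgeSet ∩ Z.edgeSet)
  diff_matching : IsEdgeMatching (H.edgeSet \ Z.edgeSet)

end Graphs

/-! ## Enhanced words -/

/-- An enhanced word of length `n` over the alphabet `{a, b}` (`true` is the letter `a`, `false` is
the letter `b`). `bottom i j` says that there is a bottom edge between the letter `a` in position
`i` and the letter `b` in position `j`, where the `a` appears before the `b`; `top i j` says that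
there is a top edge between the letter `a` in position `i` and the letter `b` in position `j`, where
the `a` appears after the `b`. The bottom edges form a matching and the top edges form a
matching. -/
structure EnhancedWord (n : ℕ) where
  letter : Fin n → Bool
  bottom : Fin n → Fin n → Prop
  top : Fin n → Fin n → Prop
  bottom_spec : ∀ i j, bottom i j → letter i = true ∧ letter j = false ∧ i < j
  top_spec : ∀ i j, top i j → letter i = true ∧ letter j = false ∧ j < i
  bottom_right_unique : ∀ i j j', bottom i j → bottom i j' → j = j'
  bottom_left_unique : ∀ i i' j, bottom i j → bottom i' j → i = i'
  top_right_unique : ∀ i j j', top i j → top i j' → j = j'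
  top_left_unique : ∀ i i' j, top i j → top i' j → i = i'

/-- The letter `a` in position `i` and the letter `b` in position `j` are joined by an edge in the
graph described by the enhanced word: either the `a` appears before the `b` and there is no bottom
edge between them, or there is a top edge between them. -/
def EnhancedWord.Joins {n : ℕ} (w : EnhancedWord n) (i j : Fin n) : Prop :=
  w.letter i = true ∧ w.letter j = false ∧ ((i < j ∧ ¬ w.bottom i j) ∨ w.top i j)

/-- The graph described by an enhanced word; its vertices are the positions in the word. -/
def EnhancedWord.graph {n : ℕ} (w : EnhancedWord n) : SimpleGraph (Fin n) where
  Adj i j := w.Joins i j ∨ w.Joins j i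
  symm := ⟨fun _ _ h => h.symm⟩
  loopless := ⟨fun i h => by
    have h' : w.Joins i i := h.elim id id
    exact absurd (h'.1.symm.trans h'.2.1) (by decide)⟩

/-- The enhanced word `w`, with the vertex `σ k` as its entry in position `k`, is an enhanced
letter representation of the bipartite graph `(G, c)`: the letters `a` are the vertices of the part
`A`, the letters `b` are the vertices of the part `B`, and `w` describes the graph `G`. -/
def EnhancedWord.Represents {n : ℕ} {V : Type*} (w : EnhancedWord n) (σ : Fin n ≃ V)
    (G : SimpleGraph V) (c : V → Bool) : Prop :=
  (∀ k, w.letter k = c (σ k)) ∧ ∀ i j, G.Adj (σ i) (σ j) ↔ w.graph.Adj i j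

/-! ## Random access machines

A random access machine with registers, a memory with indirect addressing, addition and truncated
subtraction (no multiplication), and structured control. Each instruction and each test costs one
step. Since `t` steps lengthen the binary representation of the numbers by `O(t)` bits only,
polynomial time on this machine is polynomial time on a Turing machine. -/

/-- The state of the machine: the contents of the registers and of the memory cells. -/
@[ext]
structure RamState where
  reg : ℕ → ℕ
  mem : ℕ → ℕ

/-- The elementary instructions; `x`, `y`, `z` are the numbers of registers. -/
inductive RamInstr : Type
  /-- `x := k` -/
  | const (x k : ℕ)
  /-- `x := y` -/
  | copy (x y : ℕ)
  /-- `x := y + z` -/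
  | add (x y z : ℕ)
  /-- `x := y - z`, truncated at `0` -/
  | sub (x y z : ℕ)
  /-- `x := mem[y]` -/
  | load (x y : ℕ)
  /-- `mem[x] := y` -/
  | store (x y : ℕ)

/-- The effect of an elementary instruction. -/
def RamInstr.exec : RamInstr → RamState → RamState
  | const x k, s => { s with reg := Function.update s.reg x k }
  | copy x y, s => { s with reg := Function.update s.reg x (s.reg y) }
  | add x y z, s => { s with reg := Function.update s.reg x (s.reg y + s.reg z) }
  | sub x y z, s => { s with reg := Function.update s.reg x (s.reg y - s.reg z) }
  | load x y, s => { s with reg := Function.update s.reg x (s.mem (s.reg y)) }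
  | store x y, s => { s with mem := Function.update s.mem (s.reg x) (s.reg y) }

/-- Programs. -/
inductive RamProg : Type
  /-- an elementary instruction -/
  | instr (i : RamInstr)
  /-- `p; q` -/
  | seq (p q : RamProg)
  /-- `if x ≠ 0 then p else q` -/
  | cond (x : ℕ) (p q : RamProg)
  /-- `while x ≠ 0 do p` -/
  | loop (x : ℕ) (p : RamProg)

/-- `p.Runs s s' t`: started in the state `s`, the program `p` halts in the state `s'` after exactly
`t` steps. -/
inductive RamProg.Runs : RamProg → RamState → RamState → ℕ → Prop
  | instr (i : RamInstr) (s : RamState) : Runs (.instr i) s (i.exec s) 1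
  | seq {p q : RamProg} {s s' s'' : RamState} {t t' : ℕ} :
      Runs p s s' t → Runs q s' s'' t' → Runs (.seq p q) s s'' (t + t')
  | cond_pos {x : ℕ} {p q : RamProg} {s s' : RamState} {t : ℕ} :
      s.reg x ≠ 0 → Runs p s s' t → Runs (.cond x p q) s s' (t + 1)
  | cond_zero {x : ℕ} {p q : RamProg} {s s' : RamState} {t : ℕ} :
      s.reg x = 0 → Runs q s s' t → Runs (.cond x p q) s s' (t + 1)
  | loop_pos {x : ℕ} {p : RamProg} {s s' s'' : RamState} {t t' : ℕ} :
      s.reg x ≠ 0 → Runs p s s' t → Runs (.loop x p) s' s'' t' →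
        Runs (.loop x p) s s'' (t + t' + 1)
  | loop_zero {x : ℕ} {p : RamProg} {s : RamState} :
      s.reg x = 0 → Runs (.loop x p) s s 1

/-- The initial state: the input is written in the memory from cell `0` on, and all other cells and
all registers hold `0`. -/
def RamState.ofInput (input : List ℕ) : RamState where
  reg := fun _ => 0
  mem := fun i => input.getD i 0

/-- On the given input, the program halts after at most `T` steps, with the given output in the
memory from cell `0` on. -/
def RamProg.OutputsWithin (p : RamProg) (input output : List ℕ) (T : ℕ) : Prop :=
  ∃ (s : RamState) (t : ℕ), t ≤ T ∧ p.Runs (RamState.ofInput input) s t ∧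
    ∀ (i : ℕ) (h : i < output.length), s.mem i = output[i]

/-! ## Encodings -/

open scoped Classical in
/-- The truth value of a proposition as a number `0` or `1`. -/
noncomputable def bit (P : Prop) : ℕ := if P then 1 else 0

/-- The matrix of a binary relation on `Fin n`, row by row. -/
noncomputable def encodeRel {n : ℕ} (r : Fin n → Fin n → Prop) : List ℕ :=
  (List.ofFn fun i => List.ofFn fun j => bit (r i j)).flatten

/-- A bipartite graph on `n` vertices as an input: the number `n`, then for each vertex whether it
is in the part `A`, then the adjacency matrix. -/
noncomputable def encodeBipartite {n : ℕ} (G : SimpleGraph (Fin n)) (c : Fin n → Bool) : List ℕ :=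
  n :: ((List.ofFn fun v => bit (c v = true)) ++ encodeRel G.Adj)

/-- A decomposition as an output: the adjacency matrices of the two graphs. -/
noncomputable def encodeDecomposition {n : ℕ} (Z H : SimpleGraph (Fin n)) : List ℕ :=
  encodeRel Z.Adj ++ encodeRel H.Adj

/-- An enhanced letter representation as an output: the vertices in the order of their positions in
the word, then the letters of the word, then the matrices of its bottom and top edges. -/
noncomputable def encodeRepresentation {n : ℕ} (w : EnhancedWord n) (σ : Fin n ≃ Fin n) : List ℕ :=
  (List.ofFn fun k => (σ k : ℕ)) ++ (List.ofFn fun k => bit (w.letter k = true)) ++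
    encodeRel w.bottom ++ encodeRel w.top

end QuasiChain

/-! For vertices in different parts, write an arc `u → w` (`Costs`) when listing `u` before `w`
forces a bottom or top edge: a non-edge with `u` in A, or an edge with `u` in B. Exactly one of `u →
w`, `w → u` holds, so the arcs form a bipartite tournament. An order of the vertices defines a chain
graph (each vertex of A is joined to the later vertices of B), and its symmetric difference with G
consists of the forward arcs. The matching conditions, for the decomposition and for the enhanced
word alike, say that every vertex has at most one forward arc out of it and at most one into it. It
suffices that every initial segment S is a good cut: the arcs from S to its complement form a
matching.

The quasi-chain condition says that two vertices of one part never have two private out-neighbours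
each. Hence, of two such vertices, one of smaller or equal out-degree has at most one private
out-neighbour (`eq_of_min`). The heart is `exists_isGoodCut_insert`: a good cut other than the whole
set can always be enlarged by one vertex. The greedy procedure therefore never backtracks, which
gives both existence and an algorithm.

A candidate is tested by running through triples of vertices. The algorithms are written in a small
language with bounded sums and loops; its compiler to the machine is proved correct with a
polynomial step bound (`Cmd.compile_runs`), so afterwards only values of expressions and memory
contents matter. -/

namespace QuasiChain

/-! ## Good cuts -/

section Cuts

variable {V : Type*}

/-- Placing `u` before `w` in the word makes `u`, `w` a (bottom or top) edge. -/
def Costs (G : SimpleGraph V) (c : V → Bool) (u w : V) : Prop :=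
  c u ≠ c w ∧ (G.Adj u w ↔ c u = false)

/-- The pairs across the cut `(S, Sᶜ)` that become edges when `S` precedes `Sᶜ` form a matching. -/
def IsGoodCut (D : V → V → Prop) (S : Set V) : Prop :=
  (∀ u ∈ S, ∀ w ∉ S, ∀ w' ∉ S, D u w → D u w' → w = w') ∧
    ∀ w ∉ S, ∀ u ∈ S, ∀ u' ∈ S, D u w → D u' w → u = u'

/-- A bipartite tournament in which no two vertices of the same part have two private
out-neighbours each. -/
structure IsQuasiTournament (D : V → V → Prop) (c : V → Bool) : Prop where
  ne : ∀ {u w}, D u w → c u ≠ c w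
  asymm : ∀ {u w}, D u w → ¬ D w u
  total : ∀ {u w}, c u ≠ c w → ¬ D w u → D u w
  quasi : ∀ {x y}, c x = c y → ∀ {p q r s}, p ≠ q → r ≠ s → D x p → D x q → ¬ D y p → ¬ D y q →
    D y r → D y s → ¬ D x r → ¬ D x s → False

/-! ### Quasi-chain graphs as bipartite tournaments -/

/-- The paths `p x q` and `r y s` form an induced `2P₃` with centres in one part: the pairs between
different parts are given by the hypotheses, and pairs inside a part are non-edges. -/
theorem IsQuasiChain.not_two_private {G : SimpleGraph V} {c : V → Bool} (h : IsQuasiChain G c)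
    {x y p q r s : V} (hc : c x = c y) (hpq : p ≠ q) (hrs : r ≠ s) (hxp : G.Adj x p)
    (hxq : G.Adj x q) (hyp : ¬ G.Adj y p) (hyq : ¬ G.Adj y q) (hyr : G.Adj y r) (hys : G.Adj y s)
    (hxr : ¬ G.Adj x r) (hxs : ¬ G.Adj x s) : False := by
  have hb : ∀ u v, c u = c v → ¬ G.Adj u v := fun u v e a => h.1 u v a e
  have cp := h.1 _ _ hxp
  have cq := h.1 _ _ hxq
  have cr := h.1 _ _ hyr
  have cs := h.1 _ _ hys
  have two : ∀ {a b d : Bool}, a ≠ b → a ≠ d → b = d := by decide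
  have e1 : c p = c q := two cp cq
  have e2 : c p = c r := two cp (hc ▸ cr)
  have e3 : c p = c s := two cp (hc ▸ cs)
  refine h.2 ⟨⟨⟨Sum.elim ![p, x, q] ![r, y, s], ?_⟩, ?_⟩, hc⟩
  · have nxy : x ≠ y := by rintro rfl; exact hyp hxp
    have npr : p ≠ r := by rintro rfl; exact hyp hyr
    have nps : p ≠ s := by rintro rfl; exact hyp hys
    have nqr : q ≠ r := by rintro rfl; exact hyq hyr
    have nqs : q ≠ s := by rintro rfl; exact hyq hys
    have n1 : x ≠ p := hxp.ne
    have n2 : x ≠ q := hxq.ne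
    have n3 : y ≠ r := hyr.ne
    have n4 : y ≠ s := hys.ne
    have n5 : x ≠ r := by rintro rfl; exact cr hc.symm
    have n6 : x ≠ s := by rintro rfl; exact cs hc.symm
    have n7 : y ≠ p := by rintro rfl; exact cp hc
    have n8 : y ≠ q := by rintro rfl; exact cq hc
    rintro (i | i) (j | j) hij <;> fin_cases i <;> fin_cases j <;> simp_all [eq_comm]
  · have bxy := hb _ _ hc
    have bpq := hb _ _ e1
    have bpr := hb _ _ e2
    have bps := hb _ _ e3
    have bqr := hb _ _ (e1.symm.trans e2)
    have bqs := hb _ _ (e1.symm.trans e3)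
    have brs := hb _ _ (e2.symm.trans e3)
    have symm : ∀ {u v}, ¬ G.Adj u v → ¬ G.Adj v u := fun k h => k h.symm
    intro i j
    change G.Adj (Sum.elim ![p, x, q] ![r, y, s] i) (Sum.elim ![p, x, q] ![r, y, s] j) ↔ _
    rcases i with i | i <;> rcases j with j | j <;> fin_cases i <;> fin_cases j <;>
      simp [twoP3, SimpleGraph.pathGraph_adj, hxp, hxq, hyp, hyq, hyr, hys, hxr, hxs, hxp.symm,
        hxq.symm, symm hyp, symm hyq, hyr.symm, hys.symm, symm hxr, symm hxs, bxy, bpq, bpr, bps,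
        bqr, bqs, brs, symm bxy, symm bpq, symm bpr, symm bps, symm bqr, symm bqs, symm brs]

/-- Out-neighbours are neighbours for a vertex of B and non-neighbours in B for a vertex of A. In A,
private out-neighbours of `x` are thus private neighbours of `y`, and the two roles are exchanged.
-/
theorem IsQuasiChain.isQuasiTournament {G : SimpleGraph V} {c : V → Bool} (h : IsQuasiChain G c) :
    IsQuasiTournament (Costs G c) c where
  ne h := h.1
  asymm := by
    rintro u w ⟨h1, h2⟩ ⟨_, h3⟩
    rw [G.adj_comm] at h3
    cases hu : c u <;> cases hw : c w <;> simp_all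
  total := by
    intro u w h1 h2
    refine ⟨h1, ?_⟩
    simp only [Costs, not_and, G.adj_comm w u] at h2
    have := h2 h1.symm
    cases hu : c u <;> cases hw : c w <;> simp_all
  quasi := by
    intro x y hc p q r s hpq hrs h1 h2 h3 h4 h5 h6 h7 h8
    have e1 : c y ≠ c p := hc ▸ h1.1
    have e2 : c y ≠ c q := hc ▸ h2.1
    have e3 : c x ≠ c r := hc ▸ h5.1
    have e4 : c x ≠ c s := hc ▸ h6.1
    simp only [Costs, e1, e2, e3, e4, h1.1, h2.1, h5.1, h6.1, ne_eq, not_false_eq_true,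
      true_and] at h1 h2 h3 h4 h5 h6 h7 h8
    rw [← hc] at h3 h4 h5 h6
    cases hx : c x
    · simp only [hx, iff_true] at h1 h2 h3 h4 h5 h6 h7 h8
      exact h.not_two_private hc hpq hrs h1 h2 h3 h4 h5 h6 h7 h8
    · simp only [hx, Bool.true_eq_false, iff_false, not_not] at h1 h2 h3 h4 h5 h6 h7 h8
      exact h.not_two_private hc hrs hpq h7 h8 h5 h6 h3 h4 h1 h2

/-! ### Enlarging a good cut by one vertex -/

namespace IsQuasiTournament

variable {D : V → V → Prop} {c : V → Bool} {S : Set V}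

/-- If `x` had two private out-neighbours, then `x'`, having at least as many out-neighbours in
total, would have two as well, against `quasi`. -/
theorem eq_of_min (hD : IsQuasiTournament D c) [Finite V] {x x' p q : V} (hc : c x = c x')
    (hmin : {w | D x w}.ncard ≤ {w | D x' w}.ncard) (hp : D x p) (hq : D x q) (hp' : ¬ D x' p)
    (hq' : ¬ D x' q) : p = q := by
  by_contra hne
  have h1 : 1 < ({w | D x w} \ {w | D x' w}).ncard :=
    (Set.one_lt_ncard (Set.toFinite _)).2 ⟨p, ⟨hp, hp'⟩, q, ⟨hq, hq'⟩, hne⟩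
  have h2 := Set.ncard_sdiff_add_ncard {w | D x w} {w | D x' w} (Set.toFinite _) (Set.toFinite _)
  have h3 := Set.ncard_sdiff_add_ncard {w | D x' w} {w | D x w} (Set.toFinite _) (Set.toFinite _)
  rw [Set.union_comm] at h3
  obtain ⟨r, hr, s, hs, hrs⟩ :=
    (Set.one_lt_ncard (Set.toFinite ({w | D x' w} \ {w | D x w}))).1 (by omega)
  exact hD.quasi hc hne hrs hp hq hp' hq' hr.1 hs.1 hr.2 hs.2

/-- A vertex can be moved if at most one vertex outside `S` is lost, and that one is free. -/
theorem isGoodCut_insert (hS : IsGoodCut D S) {v : V}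
    (h1 : ∀ w ∉ S, ∀ w' ∉ S, D v w → D v w' → w = w')
    (h2 : ∀ w ∉ S, D v w → ∀ u ∈ S, ¬ D u w) : IsGoodCut D (insert v S) := by
  refine ⟨?_, ?_⟩
  · rintro u (rfl | hu) w hw w' hw' h h'
    · exact h1 w (fun k => hw (.inr k)) w' (fun k => hw' (.inr k)) h h'
    · exact hS.1 u hu w (fun k => hw (.inr k)) w' (fun k => hw' (.inr k)) h h'
  · rintro w hw u (rfl | hu) u' (rfl | hu') h h'
    · rfl
    · exact absurd h' (h2 w (fun k => hw (.inr k)) h _ hu')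
    · exact absurd h (h2 w (fun k => hw (.inr k)) h' _ hu)
    · exact hS.2 w (fun k => hw (.inr k)) u hu u' hu' h h'

/-- When no vertex can be moved, a vertex of minimum out-degree has a single out-neighbour outside
`S`, and this one has an in-neighbour in `S`. -/
theorem exists_unique_of_stuck [Finite V] (hD : IsQuasiTournament D c) (hS : IsGoodCut D S)
    (hstuck : ∀ v ∉ S, ¬ IsGoodCut D (insert v S)) {x : V} (hx : x ∉ S)
    (hmin : ∀ x' ∉ S, c x' = c x → {w | D x w}.ncard ≤ {w | D x' w}.ncard) :
    ∃ w ∉ S, D x w ∧ ∃ s ∈ S, D s w := by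
  have hout : ∀ v ∉ S, ∃ w ∉ S, D v w := by
    intro v hv
    by_contra! hno
    exact hstuck v hv (isGoodCut_insert hS (fun w hw _ _ h => absurd h (hno w hw))
      fun w hw h => absurd h (hno w hw))
  have htwo : ∀ {a b d : Bool}, a ≠ b → b ≠ d → d = a := by decide
  -- a vertex hit by `x` has at least two out-neighbours outside `S`
  have hkey : ∀ w ∉ S, D x w → ∃ z ∉ S, ∃ z' ∉ S, D w z ∧ D w z' ∧ z ≠ z' := by
    intro w hw hxw
    by_contra! hno
    refine hstuck w hw (isGoodCut_insert hS (fun z hz z' hz' h h' => hno z hz z' hz' h h') ?_)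
    intro z hz hwz s hs hsz
    have hcz : c z = c x := htwo (hD.ne hxw) (hD.ne hwz)
    have hzx : z ≠ x := by rintro rfl; exact hD.asymm hxw hwz
    -- An arc `s → x` besides `s → z` would violate the matching across the cut, so the arc is `x →
    -- s`. Then `w` and `s` are both private to `x` against `z`.
    have hxs : D x s := hD.total (fun e => hD.ne hsz (e.symm.trans hcz.symm))
      fun h => hzx (hS.1 s hs z hz x hx hsz h)
    have := hD.eq_of_min hcz.symm (hmin z hz hcz) hxw hxs (hD.asymm hwz) (hD.asymm hsz)
    exact hw (this ▸ hs)
  have huniq : ∀ w ∉ S, ∀ w' ∉ S, D x w → D x w' → w = w' := by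
    intro w hw w' hw' h h'
    by_contra hne
    obtain ⟨p, hp, q, hq, hwp, hwq, hpq⟩ := hkey w hw h
    obtain ⟨r, hr, s, hs, hwr, hws, hrs⟩ := hkey w' hw' h'
    -- A common out-neighbour `z` of `w` and `w'` lies in the part of `x` and has arcs to neither of
    -- them, while `x` has arcs to both: too many for a vertex of minimum out-degree. So `w` and
    -- `w'` have two private out-neighbours each.
    have hdis : ∀ z ∉ S, D w z → D w' z → False := fun z hz k k' => by
      have hcz : c z = c x := htwo (hD.ne h) (hD.ne k)
      exact hne (hD.eq_of_min hcz.symm (hmin z hz hcz) h h' (hD.asymm k) (hD.asymm k'))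
    have hcw : c w = c w' := htwo (hD.ne h').symm (hD.ne h)
    exact hD.quasi hcw hpq hrs hwp hwq (hdis p hp hwp) (hdis q hq hwq) hwr hws
      (fun k => hdis r hr k hwr) fun k => hdis s hs k hws
  by_contra! hno
  exact hstuck x hx (isGoodCut_insert hS huniq hno)

/-- If no vertex can be moved, take `x` of minimum out-degree outside `S` in one part, with an arc
`x → w` where `w` is hit from `S`, and then `y` of minimum out-degree in the part of `w`, with an
arc `y → z` where `z` is hit from `S`. Minimality of `x` rules out `w → z` unless `x = z`, and
minimality of `y` rules out `z → w` unless `y = w`; but one of these arcs exists. -/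
theorem exists_isGoodCut_insert [Finite V] (hD : IsQuasiTournament D c) (hS : IsGoodCut D S)
    (hne : S ≠ Set.univ) : ∃ v ∉ S, IsGoodCut D (insert v S) := by
  by_contra! hstuck
  have hmin : ∀ b, (∃ v ∉ S, c v = b) → ∃ x ∉ S, c x = b ∧
      ∀ x' ∉ S, c x' = c x → {w | D x w}.ncard ≤ {w | D x' w}.ncard := by
    rintro b ⟨v, hv, hb⟩
    obtain ⟨x, ⟨hx, hxb⟩, h⟩ := Set.exists_min_image {v | v ∉ S ∧ c v = b}
      (fun x => {w | D x w}.ncard) (Set.toFinite _) ⟨v, hv, hb⟩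
    exact ⟨x, hx, hxb, fun x' hx' hc => h x' ⟨hx', hc.trans hxb⟩⟩
  obtain ⟨v, hv⟩ := (Set.ne_univ_iff_exists_notMem S).1 hne
  obtain ⟨x, hx, -, hxm⟩ := hmin (c v) ⟨v, hv, rfl⟩
  obtain ⟨w, hw, hxw, s, hs, hsw⟩ := hD.exists_unique_of_stuck hS hstuck hx hxm
  obtain ⟨y, hy, hyc, hym⟩ := hmin (c w) ⟨w, hw, rfl⟩
  obtain ⟨z, hz, hyz, s', hs', hsz⟩ := hD.exists_unique_of_stuck hS hstuck hy hym
  have htwo : ∀ {a b d : Bool}, a ≠ b → b ≠ d → d = a := by decide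
  have hcz : c z = c x := htwo (hD.ne hxw) (hyc ▸ hD.ne hyz)
  -- Since `s` already hits `z`, it cannot hit `x`, so `x → s`. With `w → z`, both `w` and `s` would
  -- be private to `x` against `z`.
  have hforce : ∀ {x z w s : V}, x ∉ S → z ∉ S → w ∉ S → s ∈ S → c z = c x →
      {w | D x w}.ncard ≤ {w | D z w}.ncard → D x w → D s z → x ≠ z → ¬ D w z := by
    intro x z w s hx hz hw hs hcz hm hxw hsz hne hwz
    have hxs : D x s := hD.total (fun e => hD.ne hsz (e.symm.trans hcz.symm))
      fun h => hne (hS.1 s hs x hx z hz h hsz)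
    exact hw (hD.eq_of_min hcz.symm hm hxw hxs (hD.asymm hwz) (hD.asymm hsz) ▸ hs)
  by_cases hxz : x = z
  · subst hxz
    by_cases hyw : y = w
    · subst hyw; exact hD.asymm hxw hyz
    · exact hforce hy hw hz hs hyc.symm (hym w hw hyc.symm) hyz hsw hyw hxw
  · have h1 := hforce hx hz hw hs' hcz (hxm z hz hcz) hxw hsz hxz
    by_cases hyw : y = w
    · subst hyw; exact h1 hyz
    · have h2 := hforce hy hw hz hs hyc.symm (hym w hw hyc.symm) hyz hsw hyw
      exact h2 (hD.total (fun e => hD.ne hyz (hyc.trans e.symm)) h1)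

end IsQuasiTournament

end Cuts

end QuasiChain

namespace QuasiChain

/-! ## Orders in which the violated pairs form two matchings -/

section Orders

variable {V : Type*}

/-- The first `k` vertices of an order are placed: `pos v` is the position of `v`, counted from
one, and `0` if `v` is not placed. -/
structure IsPartialOrder (D : V → V → Prop) (k : ℕ) (pos : V → ℕ) : Prop where
  le : ∀ v, pos v ≤ k
  inj : ∀ {u v}, pos u = pos v → pos u ≠ 0 → u = v
  surj : ∀ j, j ≠ 0 → j ≤ k → ∃ v, pos v = j
  good : ∀ j ≤ k, IsGoodCut D {v | pos v ≠ 0 ∧ pos v ≤ j}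

/-- Any two pairs `(u, w)` of the relation `D` with `u` before `w` have different first
entries and different second entries. -/
structure IsWordOrder (D : V → V → Prop) (pos : V → ℕ) : Prop where
  inj : Function.Injective pos
  right_unique : ∀ {u w w'}, pos u < pos w → pos u < pos w' → D u w → D u w' → w = w'
  left_unique : ∀ {w u u'}, pos u < pos w → pos u' < pos w → D u w → D u' w → u = u'

namespace IsPartialOrder

variable {D : V → V → Prop} {k : ℕ} {pos : V → ℕ}

theorem zero (D : V → V → Prop) : IsPartialOrder D 0 fun _ => 0 where
  le _ := le_rfl
  inj _ h := absurd rfl h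
  surj j h h' := absurd (Nat.le_zero.1 h') h
  good j _ := by simp [IsGoodCut]

theorem update [DecidableEq V] (h : IsPartialOrder D k pos) {v : V} (hv : pos v = 0)
    (hg : IsGoodCut D (insert v {u | pos u ≠ 0})) :
    IsPartialOrder D (k + 1) (Function.update pos v (k + 1)) where
  le u := by
    have := h.le u
    simp only [Function.update_apply]; split_ifs <;> omega
  inj {u w} huw hu := by
    have h1 := h.le u
    have h2 := h.le w
    simp only [Function.update_apply] at huw hu
    split_ifs at huw hu with e1 e2 e2
    · exact e1.trans e2.symm
    · omega
    · omega
    · exact h.inj huw hu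
  surj j hj hjk := by
    rcases Nat.lt_or_ge k j with hlt | hle
    · exact ⟨v, by simp; omega⟩
    · obtain ⟨u, hu⟩ := h.surj j hj hle
      exact ⟨u, by rw [Function.update_of_ne (by rintro rfl; omega), hu]⟩
  good j hj := by
    rcases Nat.lt_or_ge k j with hlt | hle
    · convert hg using 1
      ext u
      have := h.le u
      by_cases huv : u = v
      · subst huv; simp; omega
      · simp only [Function.update_apply, huv, if_false, Set.mem_ofPred_eq, Set.mem_insert_iff,
          false_or]
        exact ⟨fun k => k.1, fun k => ⟨k, by omega⟩⟩
    · convert h.good j hle using 1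
      ext u
      by_cases huv : u = v
      · subst huv; simp [hv]; omega
      · simp [huv]

theorem exists_next [Fintype V] {c : V → Bool} (hD : IsQuasiTournament D c)
    (h : IsPartialOrder D k pos) (hk : k < Fintype.card V) :
    ∃ v, pos v = 0 ∧ IsGoodCut D (insert v {u | pos u ≠ 0}) := by
  have hS : {u | pos u ≠ 0 ∧ pos u ≤ k} = {u | pos u ≠ 0} := by
    ext u; simp [h.le u]
  obtain ⟨v, hv, hg⟩ := hD.exists_isGoodCut_insert (hS ▸ h.good k le_rfl) (by
    intro hu
    have hne : ∀ u, pos u ≠ 0 := fun u => (Set.eq_univ_iff_forall.1 hu) u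
    have := Finset.card_le_card_of_injOn (s := Finset.univ) (t := Finset.Icc 1 k) pos
      (fun u _ => by
        have := hne u
        have := h.le u
        simp only [Finset.coe_Icc, Set.mem_Icc]; omega)
      (fun u _ w _ e => h.inj e (hne u))
    simp at this
    omega)
  exact ⟨v, by simpa using hv, hg⟩

/-- Otherwise `pos` would take all `card V + 1` values from `0` to `card V`. -/
theorem pos_ne_zero [Fintype V] (h : IsPartialOrder D (Fintype.card V) pos) (v : V) :
    pos v ≠ 0 := by
  classical
  intro hv
  have h1 : Finset.range (Fintype.card V + 1) ⊆ Finset.univ.image pos := by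
    intro j hj
    rw [Finset.mem_range] at hj
    rw [Finset.mem_image]
    by_cases hj0 : j = 0
    · exact ⟨v, Finset.mem_univ _, hv.trans hj0.symm⟩
    · obtain ⟨u, hu⟩ := h.surj j hj0 (by omega)
      exact ⟨u, Finset.mem_univ _, hu⟩
  have h2 := (Finset.card_le_card h1).trans Finset.card_image_le
  simp at h2

/-- The forward arcs out of `u` all cross the cut just after `u`, and those into `w` all cross the
cut just before `w`. -/
theorem isWordOrder [Fintype V] (h : IsPartialOrder D (Fintype.card V) pos) :
    IsWordOrder D pos where
  inj u w e := h.inj e (h.pos_ne_zero u)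
  right_unique {u w w'} h1 h2 h3 h4 :=
    (h.good (pos u) (h.le u)).1 u ⟨h.pos_ne_zero u, le_rfl⟩ w (fun k => by have := k.2; omega) w'
      (fun k => by have := k.2; omega) h3 h4
  left_unique {w u u'} h1 h2 h3 h4 :=
    (h.good (pos w - 1) (by have := h.le w; omega)).2 w (fun k => by have := k.2; omega)
      u ⟨h.pos_ne_zero u, by omega⟩ u' ⟨h.pos_ne_zero u', by omega⟩ h3 h4

theorem exists_of_le_card [Fintype V] {c : V → Bool} (hD : IsQuasiTournament D c) (k : ℕ)
    (hk : k ≤ Fintype.card V) : ∃ pos, IsPartialOrder D k pos := by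
  classical
  induction k with
  | zero => exact ⟨_, zero D⟩
  | succ k ih =>
    obtain ⟨pos, h⟩ := ih (by omega)
    obtain ⟨v, hv, hg⟩ := h.exists_next hD hk
    exact ⟨_, h.update hv hg⟩

end IsPartialOrder

/-! ## The decomposition given by an order -/

/-- The chain graph in which a vertex of `A` is adjacent to the vertices of `B` after it. -/
def chainOf (c : V → Bool) (pos : V → ℕ) : SimpleGraph V where
  Adj u w := c u ≠ c w ∧ (c u = true ∧ pos u < pos w ∨ c w = true ∧ pos w < pos u)
  symm := ⟨fun _ _ h => ⟨h.1.symm, h.2.symm⟩⟩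
  loopless := ⟨fun _ h => h.1 rfl⟩

theorem isChainGraph_chainOf (c : V → Bool) (pos : V → ℕ) : IsChainGraph (chainOf c pos) c := by
  refine ⟨fun u w h => h.1, fun b => ?_⟩
  rintro _ ⟨u, hu, rfl⟩ _ ⟨w, hw, rfl⟩ -
  simp only [Set.mem_ofPred_eq] at hu hw
  -- Neighbourhoods shrink along the order in A and grow along it in B.
  have key : ∀ u w : V, c u = b → c w = b → (b = true → pos w ≤ pos u) →
      (b = false → pos u ≤ pos w) → (chainOf c pos).neighborSet u ⊆
        (chainOf c pos).neighborSet w := by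
    rintro u w hu hw h1 h2 x ⟨hx, hx'⟩
    refine ⟨by rw [hw, ← hu]; exact hx, ?_⟩
    cases b
    · simp only [hu, hw, Bool.false_eq_true, false_and, false_or] at hx' ⊢
      exact ⟨hx'.1, by have := h2 rfl; omega⟩
    · have : c x = false := by rw [hu] at hx; simpa using hx.symm
      simp only [hu, hw, this, Bool.false_eq_true, false_and, or_false, true_and] at hx' ⊢
      have := h1 rfl; omega
  cases b <;> rcases le_total (pos u) (pos w) with h | h
  · exact .inl (key u w hu hw (by simp) fun _ => h)
  · exact .inr (key w u hw hu (by simp) fun _ => h)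
  · exact .inr (key w u hw hu (fun _ => h) (by simp))
  · exact .inl (key u w hu hw (fun _ => h) (by simp))

/-- The edges of the symmetric difference are the forward arcs. Injectivity of `pos` makes any two
vertices of different parts comparable. -/
theorem IsBipartition.symmDiff_chainOf_adj {G : SimpleGraph V} {c : V → Bool}
    (hG : IsBipartition G c) {pos : V → ℕ} (hpos : Function.Injective pos) {u w : V} :
    (G ∆ chainOf c pos).Adj u w ↔
      pos u < pos w ∧ Costs G c u w ∨ pos w < pos u ∧ Costs G c w u := by
  rw [symmDiff_def]
  by_cases huw : c u = c w
  · have h1 : ¬ G.Adj u w := fun h => hG u w h huw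
    simp [Costs, chainOf, huw, h1]
  · have hp : pos u ≠ pos w := fun h => huw (congrArg c (hpos h))
    simp only [SimpleGraph.sup_adj, SimpleGraph.sdiff_adj, chainOf, Costs, G.adj_comm w u]
    rcases lt_or_gt_of_ne hp with h | h <;> cases hu : c u <;> cases hw : c w <;>
      by_cases ha : G.Adj u w <;> simp_all [h.not_gt]

/-- At each vertex there is at most one forward arc out and one in, hence degree at most two. Edges
inside the chain graph are the arcs that start in A, the others are those that start in B; within
either class, sharing an end means sharing a tail or sharing a head. -/
theorem IsWordOrder.isDecomposition {G : SimpleGraph V} {c : V → Bool} (hG : IsBipartition G c)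
    {pos : V → ℕ} (h : IsWordOrder (Costs G c) pos) :
    IsDecomposition G c (chainOf c pos) (G ∆ chainOf c pos) where
  eq_symmDiff := by rw [symmDiff_comm G, symmDiff_symmDiff_cancel_left]
  chain := isChainGraph_chainOf c pos
  degree_le v := by
    have hsub : (G ∆ chainOf c pos).neighborSet v ⊆
        {w | pos v < pos w ∧ Costs G c v w} ∪ {w | pos w < pos v ∧ Costs G c w v} :=
      fun w hw => (hG.symmDiff_chainOf_adj h.inj).1 hw
    calc _ ≤ _ := Set.encard_le_encard hsub
      _ ≤ _ := Set.encard_union_le _ _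
      _ ≤ 1 + 1 := add_le_add
          (Set.encard_le_one_iff.2 fun w w' k k' => h.right_unique k.1 k'.1 k.2 k'.2)
          (Set.encard_le_one_iff.2 fun w w' k k' => h.left_unique k.1 k'.1 k.2 k'.2)
      _ = 2 := one_add_one_eq_two
  inter_matching := by
    have key : ∀ e ∈ (G ∆ chainOf c pos).edgeSet ∩ (chainOf c pos).edgeSet, ∃ a b, e = s(a, b) ∧
        c a = true ∧ c b = false ∧ pos a < pos b ∧ Costs G c a b := by
      intro e
      induction e with | _ a b => ?_
      rintro ⟨h1, h2⟩
      rw [SimpleGraph.mem_edgeSet] at h1 h2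
      rw [hG.symmDiff_chainOf_adj h.inj] at h1
      rcases h1 with ⟨h3, h4⟩ | ⟨h3, h4⟩ <;> obtain ⟨hne, ⟨h5, h6⟩ | ⟨h5, h6⟩⟩ := h2
      · exact ⟨a, b, rfl, h5, by rw [h5] at hne; simpa using hne.symm, h3, h4⟩
      · omega
      · omega
      · exact ⟨b, a, Sym2.eq_swap, h5, by rw [h5] at hne; simpa using hne, h3, h4⟩
    intro e he f hf hne v hve hvf
    obtain ⟨a, b, rfl, ha, hb, hab, k⟩ := key e he
    obtain ⟨a', b', rfl, ha', hb', hab', k'⟩ := key f hf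
    rw [Sym2.mem_iff] at hve hvf
    rcases hve with rfl | rfl <;> rcases hvf with rfl | rfl
    · exact hne (by rw [h.right_unique hab hab' k k'])
    · simp_all
    · simp_all
    · exact hne (by rw [h.left_unique hab hab' k k'])
  diff_matching := by
    have key : ∀ e ∈ (G ∆ chainOf c pos).edgeSet \ (chainOf c pos).edgeSet, ∃ a b, e = s(a, b) ∧
        c a = true ∧ c b = false ∧ pos b < pos a ∧ Costs G c b a := by
      intro e
      induction e with | _ a b => ?_
      rintro ⟨h1, h2⟩
      rw [SimpleGraph.mem_edgeSet] at h1 h2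
      rw [hG.symmDiff_chainOf_adj h.inj] at h1
      simp only [chainOf, not_and, not_or] at h2
      rcases h1 with ⟨h3, h4⟩ | ⟨h3, h4⟩
      · have h5 := h2 h4.1
        have hca : c a = false := by simpa using fun e => h5.1 e h3
        have hcb : c b = true := by have := h4.1; rw [hca] at this; simpa using this.symm
        exact ⟨b, a, Sym2.eq_swap, hcb, hca, h3, h4⟩
      · have h5 := h2 h4.1.symm
        have hcb : c b = false := by simpa using fun e => h5.2 e h3
        have hca : c a = true := by have := h4.1; rw [hcb] at this; simpa using this.symm
        exact ⟨a, b, rfl, hca, hcb, h3, h4⟩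
    intro e he f hf hne v hve hvf
    obtain ⟨a, b, rfl, ha, hb, hab, k⟩ := key e he
    obtain ⟨a', b', rfl, ha', hb', hab', k'⟩ := key f hf
    rw [Sym2.mem_iff] at hve hvf
    rcases hve with rfl | rfl <;> rcases hvf with rfl | rfl
    · exact hne (by rw [h.left_unique hab hab' k k'])
    · simp_all
    · simp_all
    · exact hne (by rw [h.right_unique hab hab' k k'])

/-! ## The enhanced word given by an order -/

/-- The enhanced word that lists the vertices by their positions. -/
def IsWordOrder.word {n : ℕ} {G : SimpleGraph V} {c : V → Bool} {pos : V → ℕ}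
    (h : IsWordOrder (Costs G c) pos) (σ : Fin n ≃ V) (hσ : ∀ k, pos (σ k) = k + 1) :
    EnhancedWord n where
  letter k := c (σ k)
  bottom i j := c (σ i) = true ∧ c (σ j) = false ∧ i < j ∧ ¬ G.Adj (σ i) (σ j)
  top i j := c (σ i) = true ∧ c (σ j) = false ∧ j < i ∧ G.Adj (σ i) (σ j)
  bottom_spec _ _ h := ⟨h.1, h.2.1, h.2.2.1⟩
  top_spec _ _ h := ⟨h.1, h.2.1, h.2.2.1⟩
  bottom_right_unique := by
    rintro i j j' ⟨h1, h2, h3, h4⟩ ⟨_, h2', h3', h4'⟩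
    exact σ.injective (h.right_unique (u := σ i) (by simp [hσ, h3]) (by simp [hσ, h3'])
      (by simp [Costs, h1, h2, h4]) (by simp [Costs, h1, h2', h4']))
  bottom_left_unique := by
    rintro i i' j ⟨h1, h2, h3, h4⟩ ⟨h1', _, h3', h4'⟩
    exact σ.injective (h.left_unique (w := σ j) (by simp [hσ, h3]) (by simp [hσ, h3'])
      (by simp [Costs, h1, h2, h4]) (by simp [Costs, h1', h2, h4']))
  -- In a top edge the `b` comes first, so the arc runs from `b` to `a` and the two uniqueness
  -- properties change roles.
  top_right_unique := by
    rintro i j j' ⟨h1, h2, h3, h4⟩ ⟨_, h2', h3', h4'⟩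
    exact σ.injective (h.left_unique (w := σ i) (by simp [hσ, h3]) (by simp [hσ, h3'])
      (by simp [Costs, h1, h2, h4.symm]) (by simp [Costs, h1, h2', h4'.symm]))
  top_left_unique := by
    rintro i i' j ⟨h1, h2, h3, h4⟩ ⟨h1', _, h3', h4'⟩
    exact σ.injective (h.right_unique (u := σ j) (by simp [hσ, h3]) (by simp [hσ, h3'])
      (by simp [Costs, h1, h2, h4.symm]) (by simp [Costs, h1', h2, h4'.symm]))

theorem IsWordOrder.word_represents {n : ℕ} {G : SimpleGraph V} {c : V → Bool} {pos : V → ℕ}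
    (hG : IsBipartition G c) (h : IsWordOrder (Costs G c) pos) (σ : Fin n ≃ V)
    (hσ : ∀ k, pos (σ k) = k + 1) : (h.word σ hσ).Represents σ G c := by
  refine ⟨fun _ => rfl, fun i j => ?_⟩
  simp only [EnhancedWord.graph, EnhancedWord.Joins, IsWordOrder.word, G.adj_comm (σ j) (σ i)]
  by_cases hc : c (σ i) = c (σ j)
  · have h1 : ¬ G.Adj (σ i) (σ j) := fun k => hG _ _ k hc
    cases hj : c (σ j) <;> simp [hc, hj, h1]
  · have hij : i ≠ j := by rintro rfl; exact hc rfl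
    rcases lt_or_gt_of_ne hij with hlt | hlt <;> cases hi : c (σ i) <;> cases hj : c (σ j) <;>
      by_cases ha : G.Adj (σ i) (σ j) <;> simp_all [hlt.not_gt]

theorem IsPartialOrder.exists_equiv {n : ℕ} {D : Fin n → Fin n → Prop} {pos : Fin n → ℕ}
    (h : IsPartialOrder D n pos) : ∃ σ : Fin n ≃ Fin n, ∀ k, pos (σ k) = k + 1 := by
  choose f hf using fun k : Fin n => h.surj (k + 1) (by omega) (by omega)
  have hinj : Function.Injective f := fun i j e => by
    have := (hf i).symm.trans ((congrArg pos e).trans (hf j))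
    omega
  exact ⟨Equiv.ofBijective f (Finite.injective_iff_bijective.1 hinj), hf⟩

end Orders

end QuasiChain

namespace QuasiChain

/-! ## A small language with bounded sums and loops, compiled to the machine -/

/-- Expressions over variables and a memory; `size` is the size `n` of the instance, and
`sum x e` is the sum of the values of `e` for `x = 0, …, n - 1`. -/
inductive Expr : Type
  | const (k : ℕ)
  | size
  | var (x : ℕ)
  | add (a b : Expr)
  | sub (a b : Expr)
  | load (a : Expr)
  | ite (a b d : Expr)
  | sum (x : ℕ) (a : Expr)

namespace Expr

/-- The value of an expression. -/
def eval (n : ℕ) : Expr → (ℕ → ℕ) → (ℕ → ℕ) → ℕ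
  | const k, _, _ => k
  | size, _, _ => n
  | var x, ρ, _ => ρ x
  | add a b, ρ, m => a.eval n ρ m + b.eval n ρ m
  | sub a b, ρ, m => a.eval n ρ m - b.eval n ρ m
  | load a, ρ, m => m (a.eval n ρ m)
  | ite a b d, ρ, m => if a.eval n ρ m ≠ 0 then b.eval n ρ m else d.eval n ρ m
  | sum x a, ρ, m => ∑ i : Fin n, a.eval n (Function.update ρ x i) m

end Expr

/-- Commands, which change the memory; `loop x p` executes `p` for `x = 0, …, n - 1`. -/
inductive Cmd : Type
  | store (a b : Expr)
  | seq (p q : Cmd)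
  | loop (x : ℕ) (p : Cmd)

namespace Cmd

/-- The memory after the execution of a command. -/
def exec (n : ℕ) : Cmd → (ℕ → ℕ) → (ℕ → ℕ) → (ℕ → ℕ)
  | store a b, ρ, m => Function.update m (a.eval n ρ m) (b.eval n ρ m)
  | seq p q, ρ, m => q.exec n ρ (p.exec n ρ m)
  | loop x p, ρ, m => Nat.rec m (fun i m' => p.exec n (Function.update ρ x i) m') n

theorem exec_loop_induction {n x : ℕ} {p : Cmd} {ρ m : ℕ → ℕ} (I : ℕ → (ℕ → ℕ) → Prop)
    (h0 : I 0 m) (hs : ∀ i < n, ∀ m', I i m' → I (i + 1) (p.exec n (Function.update ρ x i) m')) :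
    I n ((loop x p).exec n ρ m) := by
  have : ∀ j ≤ n, I j (Nat.rec m (fun i m' => p.exec n (Function.update ρ x i) m') j) := by
    intro j
    induction j with
    | zero => exact fun _ => h0
    | succ j ih => exact fun hj => hs j hj _ (ih (by omega))
  exact this n le_rfl

end Cmd

/-! ### Compilation

Register `0` holds `n`, register `2 * x + 2` holds the variable `x`, and the registers `2 * k + 1`
are used for intermediate results. -/

/-- The machine holds the size `n`, the variables `ρ` and the memory `m`. -/
structure RamState.Holds (s : RamState) (n : ℕ) (ρ m : ℕ → ℕ) : Prop where
  size : s.reg 0 = n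
  var : ∀ x, s.reg (2 * x + 2) = ρ x
  mem : s.mem = m

/-- The intermediate results below `k` are the same in both states. -/
def RamState.AgreeBelow (k : ℕ) (s s' : RamState) : Prop :=
  ∀ j < k, s'.reg (2 * j + 1) = s.reg (2 * j + 1)

theorem RamState.AgreeBelow.trans {k : ℕ} {s s' s'' : RamState} (h : s.AgreeBelow k s')
    (h' : s'.AgreeBelow k s'') : s.AgreeBelow k s'' := fun j hj => (h' j hj).trans (h j hj)

theorem RamState.AgreeBelow.mono {k l : ℕ} {s s' : RamState} (h : s.AgreeBelow l s') (hkl : k ≤ l) :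
    s.AgreeBelow k s' := fun j hj => h j (hj.trans_le hkl)

/-- Execute `p` for the variable `x` from `0` to `n - 1`, restoring the variable at the end. -/
def RamProg.forLoop (k x : ℕ) (p : RamProg) : RamProg :=
  .seq (.instr (.copy (2 * k + 1) (2 * x + 2))) <|
  .seq (.instr (.copy (2 * k + 3) 0)) <|
  .seq (.instr (.const (2 * x + 2) 0)) <|
  .seq (.loop (2 * k + 3) (.seq p <|
    .seq (.instr (.const (2 * k + 5) 1)) <|
    .seq (.instr (.add (2 * x + 2) (2 * x + 2) (2 * k + 5))) <|
      .instr (.sub (2 * k + 3) (2 * k + 3) (2 * k + 5)))) <|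
  .instr (.copy (2 * x + 2) (2 * k + 1))

/-- `m i` is the memory before round `i`, and by `hI` the invariant depends only on the intermediate
results below `k`. The body must preserve `2 * k + 1` (the saved variable) and `2 * k + 3` (the
remaining rounds), but may overwrite `2 * k + 5`, which is reset to `1` after each run of the body.
A round adds three instructions and one test to the body; the final `5` is four instructions outside
the loop and the last test. -/
theorem RamProg.forLoop_runs {k x n T : ℕ} {p : RamProg} {ρ : ℕ → ℕ} (m : ℕ → ℕ → ℕ)
    (I : ℕ → RamState → Prop)
    (hI : ∀ i s s', I i s → (∀ j < k, s'.reg (2 * j + 1) = s.reg (2 * j + 1)) → I i s')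
    (hp : ∀ i < n, ∀ s : RamState, s.Holds n (Function.update ρ x i) (m i) → I i s →
      ∃ s' t, p.Runs s s' t ∧ t ≤ T ∧ s'.Holds n (Function.update ρ x i) (m (i + 1)) ∧
        I (i + 1) s' ∧ ∀ j, k ≤ j → j < k + 2 → s'.reg (2 * j + 1) = s.reg (2 * j + 1))
    (s : RamState) (hs : s.Holds n ρ (m 0)) (h0 : I 0 s) :
    ∃ s' t, (p.forLoop k x).Runs s s' t ∧ t ≤ n * (T + 4) + 5 ∧ s'.Holds n ρ (m n) ∧ I n s' := by
  have main : ∀ r i, i + r = n → ∀ s : RamState, s.Holds n (Function.update ρ x i) (m i) → I i s →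
      s.reg (2 * k + 3) = r → ∃ s' t, (RamProg.loop (2 * k + 3) (.seq p <|
        .seq (.instr (.const (2 * k + 5) 1)) <|
        .seq (.instr (.add (2 * x + 2) (2 * x + 2) (2 * k + 5))) <|
          .instr (.sub (2 * k + 3) (2 * k + 3) (2 * k + 5)))).Runs s s' t ∧ t ≤ r * (T + 4) + 1 ∧
        s'.Holds n (Function.update ρ x n) (m n) ∧ I n s' ∧ s'.reg (2 * k + 1) = s.reg (2 * k + 1) := by
    intro r
    induction r with
    | zero =>
      rintro i rfl s hs hi hr
      exact ⟨s, 1, .loop_zero hr, by omega, hs, hi, rfl⟩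
    | succ r ih =>
      intro i hir s hs hi hr
      obtain ⟨s1, t1, r1, ht1, hs1, hi1, hk1⟩ := hp i (by omega) s hs hi
      have e1 := hk1 k le_rfl (by omega)
      have e2 := hk1 (k + 1) (by omega) (by omega)
      rw [show 2 * (k + 1) + 1 = 2 * k + 3 by ring] at e2
      have r2 := RamProg.Runs.instr (.const (2 * k + 5) 1) s1
      have r3 := RamProg.Runs.instr (.add (2 * x + 2) (2 * x + 2) (2 * k + 5))
        ((RamInstr.const (2 * k + 5) 1).exec s1)
      have r4 := RamProg.Runs.instr (.sub (2 * k + 3) (2 * k + 3) (2 * k + 5))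
        ((RamInstr.add (2 * x + 2) (2 * x + 2) (2 * k + 5)).exec
          ((RamInstr.const (2 * k + 5) 1).exec s1))
      set s4 := (RamInstr.sub (2 * k + 3) (2 * k + 3) (2 * k + 5)).exec
        ((RamInstr.add (2 * x + 2) (2 * x + 2) (2 * k + 5)).exec
          ((RamInstr.const (2 * k + 5) 1).exec s1)) with h4
      have hreg : ∀ j, s4.reg j = if j = 2 * k + 3 then r else if j = 2 * x + 2 then i + 1 else
          if j = 2 * k + 5 then 1 else s1.reg j := by
        intro j
        have hx := hs1.var x
        simp only [Function.update_self] at hx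
        have n1 : 2 * x + 2 ≠ 2 * k + 5 := by omega
        have n2 : 2 * k + 3 ≠ 2 * x + 2 := by omega
        simp only [h4, RamInstr.exec, Function.update_apply, hx, e2, hr]
        split_ifs <;> first | rfl | omega
      obtain ⟨s5, t5, r5, ht5, hs5, hi5, hk5⟩ := ih (i + 1) (by omega) s4
        ⟨by rw [hreg]; simpa using hs1.size, fun y => by
            have := hs1.var y
            rw [hreg, if_neg (by omega)]
            by_cases hy : y = x
            · subst hy; simp
            · rw [if_neg (by omega), if_neg (by omega), this]
              simp [hy], hs1.mem⟩
        (hI _ _ _ hi1 fun j hj => by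
          rw [hreg, if_neg (by omega), if_neg (by omega), if_neg (by omega)])
        (by rw [hreg, if_pos rfl])
      refine ⟨s5, _, .loop_pos (by omega) (.seq r1 (.seq r2 (.seq r3 r4))) r5, ?_, hs5, hi5, ?_⟩
      · rw [add_mul]; omega
      · rw [hk5, hreg, if_neg (by omega), if_neg (by omega), if_neg (by omega), e1]
  have r1 := RamProg.Runs.instr (.copy (2 * k + 1) (2 * x + 2)) s
  set s1 := (RamInstr.copy (2 * k + 1) (2 * x + 2)).exec s with h1
  have r2 := RamProg.Runs.instr (.copy (2 * k + 3) 0) s1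
  set s2 := (RamInstr.copy (2 * k + 3) 0).exec s1 with h2
  have r3 := RamProg.Runs.instr (.const (2 * x + 2) 0) s2
  set s3 := (RamInstr.const (2 * x + 2) 0).exec s2 with h3
  have hreg : ∀ j, s3.reg j = if j = 2 * x + 2 then 0 else if j = 2 * k + 3 then n else
      if j = 2 * k + 1 then ρ x else s.reg j := by
    intro j
    have n1 : 0 ≠ 2 * k + 1 := by omega
    simp only [h1, h2, h3, RamInstr.exec, Function.update_apply, hs.var, hs.size, if_neg n1]
  obtain ⟨s4, t4, r4, ht4, hs4, hi4, hk4⟩ := main n 0 (by omega) s3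
    ⟨by rw [hreg]; simpa using hs.size, fun y => by
      rw [hreg]
      by_cases hy : y = x
      · subst hy; simp
      · rw [if_neg (by omega), if_neg (by omega), if_neg (by omega), hs.var]; simp [hy], hs.mem⟩
    (hI _ _ _ h0 fun j hj => by
      rw [hreg, if_neg (by omega), if_neg (by omega), if_neg (by omega)])
    (by rw [hreg, if_neg (by omega), if_pos rfl])
  have r5 := RamProg.Runs.instr (.copy (2 * x + 2) (2 * k + 1)) s4
  have hx4 : s4.reg (2 * k + 1) = ρ x := by
    rw [hk4, hreg, if_neg (by omega), if_neg (by omega), if_pos rfl]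
  refine ⟨_, _, .seq r1 (.seq r2 (.seq r3 (.seq r4 r5))), by omega,
    ⟨?_, fun y => ?_, hs4.mem⟩, hI _ _ _ hi4 fun j hj => ?_⟩
  · simp [RamInstr.exec, hs4.size]
  · have := hs4.var y
    by_cases hy : y = x
    · subst hy; simp [RamInstr.exec, hx4]
    · rw [Function.update_of_ne hy] at this
      simp [RamInstr.exec, hy, this]
  · simp only [RamInstr.exec, Function.update_apply]
    rw [if_neg (by omega)]

namespace Expr

/-- A program that writes the value of the expression into register `2 * k + 1`. -/
def compile : Expr → ℕ → RamProg
  | const c, k => .instr (.const (2 * k + 1) c)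
  | size, k => .instr (.copy (2 * k + 1) 0)
  | var x, k => .instr (.copy (2 * k + 1) (2 * x + 2))
  | add a b, k => .seq (a.compile k) <| .seq (b.compile (k + 1)) <|
      .instr (.add (2 * k + 1) (2 * k + 1) (2 * k + 3))
  | sub a b, k => .seq (a.compile k) <| .seq (b.compile (k + 1)) <|
      .instr (.sub (2 * k + 1) (2 * k + 1) (2 * k + 3))
  | load a, k => .seq (a.compile k) <| .instr (.load (2 * k + 1) (2 * k + 1))
  | ite a b d, k => .seq (a.compile k) <| .cond (2 * k + 1) (b.compile k) (d.compile k)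
  -- The accumulator is `2 * k + 1`. The loop at level `k + 1` keeps `2 * k + 3` and `2 * k + 5`;
  -- its constant shares `2 * k + 7` with the value of `a`, harmlessly.
  | sum x a, k => .seq (.instr (.const (2 * k + 1) 0)) <| .forLoop (k + 1) x <|
      .seq (a.compile (k + 3)) <| .instr (.add (2 * k + 1) (2 * k + 1) (2 * k + 7))

/-- A bound on the number of steps of the compiled program. -/
noncomputable def cost : Expr → Polynomial ℕ
  | const _ => 1
  | size => 1
  | var _ => 1
  | add a b => a.cost + b.cost + 1
  | sub a b => a.cost + b.cost + 1
  | load a => a.cost + 1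
  -- Both branches are counted, so the bound depends on `n` alone.
  | ite a b d => a.cost + b.cost + d.cost + 1
  | sum _ a => Polynomial.X * (a.cost + 5) + 6

/-- `AgreeBelow` carries the induction: a second operand, evaluated at level `k + 1`, leaves the
first one intact in register `2 * k + 1`. -/
theorem compile_runs {n : ℕ} (e : Expr) : ∀ (k : ℕ) (ρ m : ℕ → ℕ) (s : RamState), s.Holds n ρ m →
    ∃ s' t, (e.compile k).Runs s s' t ∧ t ≤ e.cost.eval n ∧ s'.Holds n ρ m ∧ s.AgreeBelow k s' ∧
      s'.reg (2 * k + 1) = e.eval n ρ m := by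
  have set_temp : ∀ {s : RamState} {ρ m : ℕ → ℕ} (k v : ℕ), s.Holds n ρ m →
      RamState.Holds { s with reg := Function.update s.reg (2 * k + 1) v } n ρ m ∧
      s.AgreeBelow k { s with reg := Function.update s.reg (2 * k + 1) v } := by
    intro s ρ m k v h
    refine ⟨⟨?_, fun x => ?_, h.mem⟩, fun j hj => ?_⟩
    · simpa using h.size
    · have := h.var x
      simp only [Function.update_apply]
      rwa [if_neg (by omega)]
    · simp only [Function.update_apply]
      rw [if_neg (by omega)]
  induction e with
  | const c =>
    intro k ρ m s h
    exact ⟨_, _, .instr _ s, by simp [cost], (set_temp k c h).1, (set_temp k c h).2,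
      by simp [RamInstr.exec, eval]⟩
  | size =>
    intro k ρ m s h
    exact ⟨_, _, .instr _ s, by simp [cost], (set_temp k _ h).1, (set_temp k _ h).2,
      by simp [RamInstr.exec, eval, h.size]⟩
  | var x =>
    intro k ρ m s h
    exact ⟨_, _, .instr _ s, by simp [cost], (set_temp k _ h).1, (set_temp k _ h).2,
      by simp [RamInstr.exec, eval, h.var]⟩
  | add a b iha ihb =>
    intro k ρ m s h
    obtain ⟨s1, t1, r1, ht1, h1, a1, e1⟩ := iha k ρ m s h
    obtain ⟨s2, t2, r2, ht2, h2, a2, e2⟩ := ihb (k + 1) ρ m s1 h1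
    have e3 := a2 k (by omega)
    refine ⟨_, _, .seq r1 (.seq r2 (.instr _ _)), by simp [cost]; omega, (set_temp k _ h2).1,
      (a1.trans (a2.mono (by omega))).trans (set_temp k _ h2).2, ?_⟩
    rw [show 2 * (k + 1) + 1 = 2 * k + 3 by ring] at e2
    simp [RamInstr.exec, eval, e1, e2, e3]
  | sub a b iha ihb =>
    intro k ρ m s h
    obtain ⟨s1, t1, r1, ht1, h1, a1, e1⟩ := iha k ρ m s h
    obtain ⟨s2, t2, r2, ht2, h2, a2, e2⟩ := ihb (k + 1) ρ m s1 h1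
    have e3 := a2 k (by omega)
    refine ⟨_, _, .seq r1 (.seq r2 (.instr _ _)), by simp [cost]; omega, (set_temp k _ h2).1,
      (a1.trans (a2.mono (by omega))).trans (set_temp k _ h2).2, ?_⟩
    rw [show 2 * (k + 1) + 1 = 2 * k + 3 by ring] at e2
    simp [RamInstr.exec, eval, e1, e2, e3]
  | load a iha =>
    intro k ρ m s h
    obtain ⟨s1, t1, r1, ht1, h1, a1, e1⟩ := iha k ρ m s h
    exact ⟨_, _, .seq r1 (.instr _ _), by simp [cost]; omega, (set_temp k _ h1).1,
      a1.trans (set_temp k _ h1).2, by simp [RamInstr.exec, eval, e1, h1.mem]⟩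
  | ite a b d iha ihb ihd =>
    intro k ρ m s h
    obtain ⟨s1, t1, r1, ht1, h1, a1, e1⟩ := iha k ρ m s h
    by_cases h0 : a.eval n ρ m = 0
    · obtain ⟨s2, t2, r2, ht2, h2, a2, e2⟩ := ihd k ρ m s1 h1
      exact ⟨_, _, .seq r1 (.cond_zero (e1.trans h0) r2), by simp [cost]; omega, h2, a1.trans a2,
        by simp [eval, h0, e2]⟩
    · obtain ⟨s2, t2, r2, ht2, h2, a2, e2⟩ := ihb k ρ m s1 h1
      exact ⟨_, _, .seq r1 (.cond_pos (by rwa [e1]) r2), by simp [cost]; omega, h2, a1.trans a2,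
        by simp [eval, h0, e2]⟩
  | sum x a iha =>
    intro k ρ m s h
    have h0 := set_temp k 0 h
    obtain ⟨s1, t1, r1, ht1, h1, a1, e1⟩ := RamProg.forLoop_runs (k := k + 1) (x := x) (n := n)
      (T := a.cost.eval n + 1) (ρ := ρ)
      (p := .seq (a.compile (k + 3)) <| .instr (.add (2 * k + 1) (2 * k + 1) (2 * k + 7)))
      (fun _ => m)
      (fun i s' => s.AgreeBelow k s' ∧ s'.reg (2 * k + 1) =
        ∑ j ∈ Finset.range i, a.eval n (Function.update ρ x j) m)
      (fun i s1 s2 hi hr => ⟨hi.1.trans fun j hj => hr j (by omega), (hr k (by omega)).trans hi.2⟩)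
      (by
        intro i _ s1 hs1 hi
        obtain ⟨s2, t2, r2, ht2, h2, a2, e2⟩ := iha (k + 3) _ m s1 hs1
        rw [show 2 * (k + 3) + 1 = 2 * k + 7 by ring] at e2
        have e3 := a2 k (by omega)
        refine ⟨_, _, .seq r2 (.instr _ _), by omega, (set_temp k _ h2).1,
          ⟨(hi.1.trans (a2.mono (by omega))).trans (set_temp k _ h2).2, ?_⟩, fun j hj hj' => ?_⟩
        · simp [RamInstr.exec, e2, e3, hi.2, Finset.sum_range_succ]
        · have := a2 j (by omega)
          simp only [RamInstr.exec, Function.update_apply]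
          rw [if_neg (by omega), this])
      _ h0.1 ⟨h0.2, by simp⟩
    refine ⟨_, _, .seq (.instr _ _) r1, ?_, h1, a1, ?_⟩
    · simp only [cost, Polynomial.eval_add, Polynomial.eval_mul, Polynomial.eval_X,
        Polynomial.eval_ofNat]
      rw [show a.cost.eval n + 1 + 4 = a.cost.eval n + 5 by ring] at ht1
      omega
    · rw [e1, eval, Finset.sum_range]

end Expr

namespace Cmd

/-- A program that executes the command. -/
def compile : Cmd → ℕ → RamProg
  | store a b, k => .seq (a.compile k) <| .seq (b.compile (k + 1)) <|
      .instr (.store (2 * k + 1) (2 * k + 3))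
  | seq p q, k => .seq (p.compile k) (q.compile k)
  -- Level `k + 2` spares the saved variable and the counter of the loop.
  | loop x p, k => .forLoop k x (p.compile (k + 2))

/-- A bound on the number of steps of the compiled program. -/
noncomputable def cost : Cmd → Polynomial ℕ
  | store a b => a.cost + b.cost + 1
  | seq p q => p.cost + q.cost
  | loop _ p => Polynomial.X * (p.cost + 4) + 5

theorem compile_runs {n : ℕ} (p : Cmd) : ∀ (k : ℕ) (ρ m : ℕ → ℕ) (s : RamState), s.Holds n ρ m →
    ∃ s' t, (p.compile k).Runs s s' t ∧ t ≤ p.cost.eval n ∧ s'.Holds n ρ (p.exec n ρ m) ∧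
      s.AgreeBelow k s' := by
  induction p with
  | store a b =>
    intro k ρ m s h
    obtain ⟨s1, t1, r1, ht1, h1, a1, e1⟩ := a.compile_runs k ρ m s h
    obtain ⟨s2, t2, r2, ht2, h2, a2, e2⟩ := b.compile_runs (k + 1) ρ m s1 h1
    have e3 := a2 k (by omega)
    rw [show 2 * (k + 1) + 1 = 2 * k + 3 by ring] at e2
    refine ⟨_, _, .seq r1 (.seq r2 (.instr _ _)), by simp [cost]; omega, ⟨h2.size, h2.var, ?_⟩,
      a1.trans (a2.mono (by omega))⟩
    simp [RamInstr.exec, exec, e1, e2, e3, h2.mem]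
  | seq p q ihp ihq =>
    intro k ρ m s h
    obtain ⟨s1, t1, r1, ht1, h1, a1⟩ := ihp k ρ m s h
    obtain ⟨s2, t2, r2, ht2, h2, a2⟩ := ihq k ρ _ s1 h1
    exact ⟨_, _, .seq r1 r2, by simp [cost]; omega, h2, a1.trans a2⟩
  | loop x p ih =>
    intro k ρ m s h
    obtain ⟨s1, t1, r1, ht1, h1, a1⟩ := RamProg.forLoop_runs (k := k) (x := x) (n := n)
      (T := p.cost.eval n) (ρ := ρ) (p := p.compile (k + 2))
      (fun i => Nat.rec m (fun i m' => p.exec n (Function.update ρ x i) m') i)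
      (fun i s' => s.AgreeBelow k s')
      (fun i s1 s2 hi hr => hi.trans hr)
      (by
        intro i _ s1 hs1 hi
        obtain ⟨s2, t2, r2, ht2, h2, a2⟩ := ih (k + 2) _ _ s1 hs1
        exact ⟨s2, t2, r2, ht2, h2, hi.trans (a2.mono (by omega)), fun j _ hj => a2 j hj⟩)
      s h (fun _ _ => rfl)
    exact ⟨s1, t1, r1, by simpa [cost] using ht1, h1, a1⟩

/-- The program for an input whose first entry is the size of the instance. -/
def program (p : Cmd) : RamProg :=
  -- Register `0` initially holds `0`, so this reads cell `0`, which contains `n`.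
  .seq (.instr (.load 0 0)) (p.compile 0)

theorem program_outputsWithin (p : Cmd) {n : ℕ} {l output : List ℕ}
    (h : ∀ (i : ℕ) (hi : i < output.length),
      p.exec n (fun _ => 0) (fun i => (n :: l).getD i 0) i = output[i]) :
    p.program.OutputsWithin (n :: l) output ((p.cost + 1).eval n) := by
  obtain ⟨s1, t1, r1, ht1, h1, -⟩ := p.compile_runs (n := n) 0 (fun _ => 0) (fun i => (n :: l).getD i 0)
    ((RamInstr.load 0 0).exec (RamState.ofInput (n :: l)))
    ⟨by simp [RamInstr.exec, RamState.ofInput], fun x => by simp [RamInstr.exec, RamState.ofInput],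
      rfl⟩
  refine ⟨s1, _, ?_, .seq (.instr _ _) r1, fun i hi => ?_⟩
  · simp; omega
  · rw [h1.mem, h i hi]

end Cmd

end QuasiChain

namespace QuasiChain

/-! ## Logical expressions -/

namespace Expr

/-- An expression used as a condition holds when its value is not zero. -/
def Holds (n : ℕ) (e : Expr) (ρ m : ℕ → ℕ) : Prop := e.eval n ρ m ≠ 0

def not (a : Expr) : Expr := ite a (const 0) (const 1)
def and (a b : Expr) : Expr := ite a b (const 0)
def or (a b : Expr) : Expr := ite a (const 1) b
def imp (a b : Expr) : Expr := ite a b (const 1)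
def lt (a b : Expr) : Expr := sub b a
def eq (a b : Expr) : Expr := not (or (sub a b) (sub b a))
-- The sum is positive exactly when some term is, that is, when `a` fails for some value of `x`.
def all (x : ℕ) (a : Expr) : Expr := not (sum x (not a))
def truth (a : Expr) : Expr := ite a (const 1) (const 0)

variable {n : ℕ} {ρ m : ℕ → ℕ} {a b d : Expr} {x : ℕ}

theorem eval_ite_pos (h : a.Holds n ρ m) : (ite a b d).eval n ρ m = b.eval n ρ m := if_pos h

theorem eval_ite_neg (h : ¬ a.Holds n ρ m) : (ite a b d).eval n ρ m = d.eval n ρ m := if_neg h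

@[simp] theorem holds_ite : (ite a b d).Holds n ρ m ↔
    (a.Holds n ρ m → b.Holds n ρ m) ∧ (¬ a.Holds n ρ m → d.Holds n ρ m) := by
  by_cases h : a.eval n ρ m = 0 <;> simp [Holds, eval, h]

@[simp] theorem holds_const {k : ℕ} : (const k).Holds n ρ m ↔ k ≠ 0 := Iff.rfl

@[simp] theorem holds_not : (not a).Holds n ρ m ↔ ¬ a.Holds n ρ m := by simp [not]

@[simp] theorem holds_and : (and a b).Holds n ρ m ↔ a.Holds n ρ m ∧ b.Holds n ρ m := by
  simp only [and, holds_ite, holds_const]; tauto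

@[simp] theorem holds_or : (or a b).Holds n ρ m ↔ a.Holds n ρ m ∨ b.Holds n ρ m := by
  simp only [or, holds_ite, holds_const]; tauto

@[simp] theorem holds_imp : (imp a b).Holds n ρ m ↔ (a.Holds n ρ m → b.Holds n ρ m) := by
  simp [imp]

@[simp] theorem holds_lt : (lt a b).Holds n ρ m ↔ a.eval n ρ m < b.eval n ρ m := by
  simp only [lt, Holds, eval]; omega

@[simp] theorem holds_eq : (eq a b).Holds n ρ m ↔ a.eval n ρ m = b.eval n ρ m := by
  rw [eq, holds_not, holds_or]; simp only [Holds, eval]; omega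

@[simp] theorem holds_all : (all x a).Holds n ρ m ↔
    ∀ i : Fin n, a.Holds n (Function.update ρ x i) m := by
  rw [all, holds_not, Holds, not_not, eval, Finset.sum_eq_zero_iff]
  refine forall_congr' fun i => ?_
  rw [← not_iff_not]
  simpa [Holds] using holds_not (n := n) (ρ := Function.update ρ x i) (m := m) (a := a)

theorem eval_truth : (truth a).eval n ρ m = bit (a.Holds n ρ m) := by
  by_cases h : a.eval n ρ m = 0 <;> simp [truth, eval, bit, Holds, h]

end Expr

theorem bit_ne_zero {P : Prop} : bit P ≠ 0 ↔ P := by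
  by_cases h : P <;> simp [bit, h]

/-! ## Lists in the memory -/

/-- The memory contains the list `l` from the cell `B` on. -/
def Stored (m : ℕ → ℕ) (B : ℕ) (l : List ℕ) : Prop :=
  ∀ (i : ℕ) (h : i < l.length), m (B + i) = l[i]

theorem stored_append {m : ℕ → ℕ} {B : ℕ} {l l' : List ℕ} :
    Stored m B (l ++ l') ↔ Stored m B l ∧ Stored m (B + l.length) l' := by
  constructor
  · intro h
    refine ⟨fun i hi => ?_, fun i hi => ?_⟩
    · rw [h i (by simp; omega), List.getElem_append_left hi]
    · rw [add_assoc, h _ (by simp; omega), List.getElem_append_right (by omega)]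
      simp
  · rintro ⟨h, h'⟩ i hi
    rcases Nat.lt_or_ge i l.length with hlt | hge
    · rw [h i hlt, List.getElem_append_left hlt]
    · rw [List.getElem_append_right hge, ← h' (i - l.length) (by simp at hi; omega)]
      congr 1; omega

theorem stored_ofFn {m : ℕ → ℕ} {B n : ℕ} {f : Fin n → ℕ} :
    Stored m B (List.ofFn f) ↔ ∀ i : Fin n, m (B + i) = f i := by
  refine ⟨fun h i => ?_, fun h i hi => ?_⟩
  · rw [h i (by simp)]; simp
  · rw [List.getElem_ofFn, ← h]

theorem Fin.mul_add_lt_sq {n : ℕ} (i j : Fin n) : (i : ℕ) * n + j < n * n := by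
  have := Nat.mul_le_mul_right n (Nat.succ_le_of_lt i.2)
  rw [Nat.succ_mul] at this
  omega

/-- Flattening the rows into one vector reduces statements about stored matrices to `stored_ofFn`.
-/
theorem encodeRel_eq {n : ℕ} (r : Fin n → Fin n → Prop) : encodeRel r =
    List.ofFn fun t : Fin (n * n) => bit (r t.divNat t.modNat) := by
  rw [encodeRel, List.ofFn_mul]
  congr 2
  funext i
  congr 1
  funext j
  have h : (⟨(i : ℕ) * n + j, Fin.mul_add_lt_sq i j⟩ : Fin (n * n)) = finProdFinEquiv (i, j) :=
    Fin.ext (by simp; ring)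
  have h2 : (finProdFinEquiv (i, j)).divNat = i ∧ (finProdFinEquiv (i, j)).modNat = j :=
    Prod.ext_iff.1 (finProdFinEquiv.symm_apply_apply (i, j))
  rw [h, h2.1, h2.2]

@[simp] theorem length_encodeRel {n : ℕ} (r : Fin n → Fin n → Prop) :
    (encodeRel r).length = n * n := by
  rw [encodeRel_eq, List.length_ofFn]

theorem stored_encodeRel {m : ℕ → ℕ} {B n : ℕ} {r : Fin n → Fin n → Prop} :
    Stored m B (encodeRel r) ↔ ∀ i j : Fin n, m (B + (i * n + j)) = bit (r i j) := by
  rw [encodeRel_eq, stored_ofFn]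
  constructor
  · intro h i j
    have h2 : (finProdFinEquiv (i, j)).divNat = i ∧ (finProdFinEquiv (i, j)).modNat = j :=
      Prod.ext_iff.1 (finProdFinEquiv.symm_apply_apply (i, j))
    have := h (finProdFinEquiv (i, j))
    rw [h2.1, h2.2] at this
    rw [← this]
    congr 2
    simp; ring
  · intro h t
    rw [← h]
    congr 2
    exact (Nat.div_add_mod' _ _).symm

/-! ## Writing vectors and matrices -/

open QuasiChain.Expr

/-- `n * n` -/
def sizeSq : Expr := sum 0 size

@[simp] theorem eval_sizeSq {n : ℕ} {ρ m : ℕ → ℕ} : sizeSq.eval n ρ m = n * n := by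
  simp [sizeSq, eval]

/-- `i * n + j` -/
def entry (i j : Expr) : Expr := add (sum 0 i) j

/-- Write the values of `e` for `x₁ = 0, …, n - 1` into the cells from `b` on. -/
def fillVec (b e : Expr) : Cmd := .loop 1 (.store (add b (var 1)) e)

/-- Write the values of `e` for `x₁, x₂ = 0, …, n - 1` into the cells from `b` on. -/
def fillMat (b e : Expr) : Cmd := .loop 1 (.loop 2 (.store (add b (entry (var 1) (var 2))) e))

/-- The two memories agree outside the `k` cells from `B` on. -/
def AgreeOutside (B k : ℕ) (m m' : ℕ → ℕ) : Prop := ∀ a, a < B ∨ B + k ≤ a → m' a = m a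

theorem Stored.of_agreeOutside {m m' : ℕ → ℕ} {B k B' : ℕ} {l : List ℕ} (h : Stored m B' l)
    (hm : AgreeOutside B k m m') (hB : B' + l.length ≤ B ∨ B + k ≤ B') : Stored m' B' l :=
  fun i hi => by rw [hm _ (by omega), h i hi]

/-- `he` is required for all memories that differ from `m` only in the target cells, since later
entries are computed after earlier ones have been written. -/
theorem exec_fillVec {n B : ℕ} {b e : Expr} {ρ m : ℕ → ℕ} (f : Fin n → ℕ)
    (hb : ∀ ρ m, b.eval n ρ m = B)
    (he : ∀ m', AgreeOutside B n m m' → ∀ (ρ : ℕ → ℕ) (i : Fin n), ρ 1 = i →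
      e.eval n ρ m' = f i) :
    Stored ((fillVec b e).exec n ρ m) B (List.ofFn f) ∧
      AgreeOutside B n m ((fillVec b e).exec n ρ m) := by
  rw [stored_ofFn]
  have := Cmd.exec_loop_induction (n := n) (x := 1) (p := .store (add b (var 1)) e) (ρ := ρ)
    (m := m) (fun k m' => (∀ i : Fin n, i < k → m' (B + i) = f i) ∧ AgreeOutside B n m m')
    ⟨fun i hi => absurd hi (by omega), fun _ _ => rfl⟩
    (by
      rintro k hk m' ⟨h1, h2⟩
      simp only [Cmd.exec, eval, hb, Function.update_self, he m' h2 _ ⟨k, hk⟩ (Function.update_self ..)]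
      refine ⟨fun i hi => ?_, fun a ha => ?_⟩
      · rcases Nat.lt_succ_iff_lt_or_eq.1 hi with hlt | heq
        · rw [Function.update_of_ne (by omega), h1 i hlt]
        · rw [heq, Function.update_self]
          congr 1; exact Fin.ext heq.symm
      · rw [Function.update_of_ne (by omega), h2 a ha])
  exact ⟨fun i => this.1 i i.2, this.2⟩

theorem exec_fillMat {n B : ℕ} {b e : Expr} {ρ m : ℕ → ℕ} (r : Fin n → Fin n → Prop)
    (hb : ∀ ρ m, b.eval n ρ m = B)
    (he : ∀ m', AgreeOutside B (n * n) m m' → ∀ (ρ : ℕ → ℕ) (i j : Fin n), ρ 1 = i → ρ 2 = j →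
      e.eval n ρ m' = bit (r i j)) :
    Stored ((fillMat b e).exec n ρ m) B (encodeRel r) ∧
      AgreeOutside B (n * n) m ((fillMat b e).exec n ρ m) := by
  -- The first `k` entries in row-major order are written; the outer loop maintains `I (k * n)`, the
  -- inner one `I (k * n + l)`.
  let I : ℕ → (ℕ → ℕ) → Prop := fun k m' =>
    (∀ i j : Fin n, (i : ℕ) * n + j < k → m' (B + (i * n + j)) = bit (r i j)) ∧
      AgreeOutside B (n * n) m m'
  have hinj : ∀ i j i' j' : Fin n, (i : ℕ) * n + j = i' * n + j' → i = i' ∧ j = j' := by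
    intro i j i' j' h
    have : finProdFinEquiv (i, j) = finProdFinEquiv (i', j') := Fin.ext (by
      simp only [finProdFinEquiv_apply_val]; linarith)
    simpa using finProdFinEquiv.injective this
  have := Cmd.exec_loop_induction (n := n) (x := 1)
    (p := .loop 2 (.store (add b (entry (var 1) (var 2))) e)) (ρ := ρ) (m := m)
    (fun k => I (k * n)) ⟨fun i j hi => absurd hi (by omega), fun _ _ => rfl⟩
    (by
      intro k hk m' hI
      have := Cmd.exec_loop_induction (n := n) (x := 2)
        (p := .store (add b (entry (var 1) (var 2))) e) (ρ := Function.update ρ 1 k) (m := m')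
        (fun l => I (k * n + l)) hI
        (by
          rintro l hl m'' ⟨h1, h2⟩
          have hkl := Fin.mul_add_lt_sq ⟨k, hk⟩ ⟨l, hl⟩
          have e1 := he m'' h2 (Function.update (Function.update ρ 1 k) 2 l) ⟨k, hk⟩ ⟨l, hl⟩
            (by simp) (by simp)
          have e2 : (entry (var 1) (var 2)).eval n
              (Function.update (Function.update ρ 1 k) 2 l) m'' = k * n + l := by
            simp [entry, eval, mul_comm]
          simp only [Cmd.exec, e1]
          rw [eval, hb, e2]
          simp only at hkl
          refine ⟨fun i j hij => ?_, fun a ha => ?_⟩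
          · rcases Nat.lt_succ_iff_lt_or_eq.1 (show _ < (k * n + l) + 1 from hij) with hlt | heq
            · rw [Function.update_of_ne (by omega), h1 i j hlt]
            · rw [heq, Function.update_self]
              obtain ⟨rfl, rfl⟩ := hinj i j ⟨k, hk⟩ ⟨l, hl⟩ heq
              rfl
          · rw [Function.update_of_ne (by omega), h2 a ha])
      rw [← Nat.succ_mul] at this
      exact this)
  exact ⟨stored_encodeRel.2 fun i j => this.1 i j (Fin.mul_add_lt_sq i j), this.2⟩

/-! ## The algorithms

The memory is divided into blocks of `n * n + n + 1` cells: the output is written into the first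
two blocks, and the following blocks hold the partition, the adjacency matrix and the positions of
the vertices. -/

/-- The address of a block. -/
def block : ℕ → Expr
  | 0 => const 0
  | i + 1 => add (block i) (add (add sizeSq size) (const 1))

@[simp] theorem eval_block {n : ℕ} {ρ m : ℕ → ℕ} (i : ℕ) :
    (block i).eval n ρ m = i * (n * n + n + 1) := by
  induction i with
  | zero => simp [block, eval]
  | succ i ih => simp [block, eval, ih, Nat.succ_mul]

def partOf (a : Expr) : Expr := load (add (block 2) a)
def adjOf (a b : Expr) : Expr := load (add (block 3) (entry a b))
def posOf (a : Expr) : Expr := load (add (block 4) a)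

/-- The memory holds the partition, the adjacency matrix and the positions. -/
structure Layout {n : ℕ} (G : SimpleGraph (Fin n)) (c : Fin n → Bool) (pos : Fin n → ℕ)
    (m : ℕ → ℕ) : Prop where
  part : Stored m (2 * (n * n + n + 1)) (List.ofFn fun v => bit (c v = true))
  adj : Stored m (3 * (n * n + n + 1)) (encodeRel G.Adj)
  pos : Stored m (4 * (n * n + n + 1)) (List.ofFn pos)

/-- The vertex `x` precedes the vertex `y` at the cost of an edge. -/
def costsOf (x y : Expr) : Expr :=
  ite (partOf x) (and (not (partOf y)) (not (adjOf x y))) (and (partOf y) (adjOf x y))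

/-- The vertex `x` is placed once `v` is. -/
def placedWith (v x : ℕ) : Expr := or (posOf (var x)) (eq (var x) (var v))

/-- The vertex `v` can be placed next. -/
def canPlace (v : ℕ) : Expr :=
  and (not (posOf (var v))) <| all 2 <| all 3 <| all 4 <| and
    (imp (placedWith v 2) <| imp (not (placedWith v 3)) <| imp (not (placedWith v 4)) <|
      imp (costsOf (var 2) (var 3)) <| imp (costsOf (var 2) (var 4)) <| eq (var 3) (var 4))
    (imp (not (placedWith v 2)) <| imp (placedWith v 3) <| imp (placedWith v 4) <|
      imp (costsOf (var 3) (var 2)) <| imp (costsOf (var 4) (var 2)) <| eq (var 3) (var 4))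

/-- The first vertex that can be placed next. -/
def nextVertex : Expr :=
  sum 1 (ite (and (canPlace 1) (all 5 (imp (lt (var 5) (var 1)) (not (canPlace 5)))))
    (var 1) (const 0))

/-- Compute the positions of the vertices. -/
def placeAll : Cmd := .loop 6 (.store (add (block 4) nextVertex) (add (var 6) (const 1)))

/-- Move the input away and compute the positions of the vertices. -/
def prepare : Cmd :=
  .seq (fillVec (block 2) (load (add (const 1) (var 1)))) <|
  .seq (fillMat (block 3) (load (add (add (const 1) size) (entry (var 1) (var 2))))) placeAll

/-! ### Correctness of the greedy search -/

namespace Layout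

variable {n : ℕ} {G : SimpleGraph (Fin n)} {c : Fin n → Bool} {pos : Fin n → ℕ} {ρ m : ℕ → ℕ}

/-- The first two blocks can be overwritten by the output without harm. -/
theorem of_agree (h : Layout G c pos m) {m' : ℕ → ℕ}
    (hm : ∀ a, 2 * (n * n + n + 1) ≤ a → m' a = m a) : Layout G c pos m' where
  part i hi := by rw [hm _ (by omega), h.part i hi]
  adj i hi := by rw [hm _ (by omega), h.adj i hi]
  pos i hi := by rw [hm _ (by omega), h.pos i hi]

theorem holds_partOf (h : Layout G c pos m) {a : Expr} {u : Fin n} (ha : a.eval n ρ m = u) :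
    (partOf a).Holds n ρ m ↔ c u = true := by
  simp only [partOf, Holds, eval, eval_block, ha]
  rw [stored_ofFn.1 h.part u, bit_ne_zero]

theorem eval_posOf (h : Layout G c pos m) {a : Expr} {u : Fin n} (ha : a.eval n ρ m = u) :
    (posOf a).eval n ρ m = pos u := by
  simp only [posOf, eval, eval_block, ha]
  rw [stored_ofFn.1 h.pos u]

/-- `entry` multiplies by `n` through a sum over variable `0`, so the value of `a` must not depend
on that variable. -/
theorem holds_adjOf (h : Layout G c pos m) {a b : Expr} {u w : Fin n}
    (ha : ∀ i, a.eval n (Function.update ρ 0 i) m = u) (hb : b.eval n ρ m = w) :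
    (adjOf a b).Holds n ρ m ↔ G.Adj u w := by
  simp only [adjOf, entry, Holds, eval, eval_block, ha, hb, Finset.sum_const, Finset.card_univ,
    Fintype.card_fin, smul_eq_mul]
  rw [mul_comm n (u : ℕ), stored_encodeRel.1 h.adj u w, bit_ne_zero]

theorem holds_costsOf (h : Layout G c pos m) {x y : ℕ} {u w : Fin n} (hx0 : x ≠ 0)
    (hx : ρ x = u) (hy : ρ y = w) :
    (costsOf (var x) (var y)).Holds n ρ m ↔ Costs G c u w := by
  rw [costsOf, holds_ite, holds_and, holds_and, holds_not, holds_not,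
    h.holds_partOf (u := u) (by simpa [eval] using hx),
    h.holds_partOf (u := w) (by simpa [eval] using hy),
    h.holds_adjOf (u := u) (w := w) (by simpa [eval, hx0] using hx) (by simpa [eval] using hy)]
  cases hu : c u <;> cases hw : c w <;> simp [Costs, hu, hw]

theorem holds_placedWith (h : Layout G c pos m) {v x : ℕ} {u w : Fin n}
    (hv : ρ v = u) (hx : ρ x = w) :
    (placedWith v x).Holds n ρ m ↔ w ∈ insert u {u | pos u ≠ 0} := by
  rw [placedWith, holds_or, holds_eq, Holds, h.eval_posOf (u := w) (by simpa [eval] using hx)]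
  simp [eval, hv, hx, Fin.ext_iff, or_comm]

/-- The restriction on `v` keeps it apart from the bound variables `2`, `3`, `4` and from variable
`0`, which `entry` uses. -/
theorem holds_canPlace (h : Layout G c pos m) {v : ℕ} {u : Fin n} (hv : 4 < v ∨ v = 1)
    (hu : ρ v = u) : (canPlace v).Holds n ρ m ↔
      pos u = 0 ∧ IsGoodCut (Costs G c) (insert u {u | pos u ≠ 0}) := by
  rw [canPlace, holds_and, holds_not, Holds, h.eval_posOf (u := u) (by simpa [eval] using hu),
    not_not]
  refine and_congr_right fun _ => ?_
  simp only [holds_all]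
  have key : ∀ p q s : Fin n, (and
      (imp (placedWith v 2) <| imp (not (placedWith v 3)) <| imp (not (placedWith v 4)) <|
        imp (costsOf (var 2) (var 3)) <| imp (costsOf (var 2) (var 4)) <| eq (var 3) (var 4))
      (imp (not (placedWith v 2)) <| imp (placedWith v 3) <| imp (placedWith v 4) <|
        imp (costsOf (var 3) (var 2)) <| imp (costsOf (var 4) (var 2)) <|
          eq (var 3) (var 4))).Holds n
        (Function.update (Function.update (Function.update ρ 2 p) 3 q) 4 s) m ↔
      (p ∈ insert u {u | pos u ≠ 0} → q ∉ insert u {u | pos u ≠ 0} →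
        s ∉ insert u {u | pos u ≠ 0} → Costs G c p q → Costs G c p s → q = s) ∧
      (p ∉ insert u {u | pos u ≠ 0} → q ∈ insert u {u | pos u ≠ 0} →
        s ∈ insert u {u | pos u ≠ 0} → Costs G c q p → Costs G c s p → q = s) := by
    intro p q s
    set τ := Function.update (Function.update (Function.update ρ 2 p) 3 q) 4 s with hτ
    have h2 : τ 2 = p := by simp [hτ]
    have h3 : τ 3 = q := by simp [hτ]
    have h4 : τ 4 = s := by simp [hτ]
    have h5 : τ v = u := by
      rw [hτ, Function.update_of_ne (by omega), Function.update_of_ne (by omega),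
        Function.update_of_ne (by omega), hu]
    simp only [holds_and, holds_imp, holds_not, h.holds_placedWith h5 h2, h.holds_placedWith h5 h3,
      h.holds_placedWith h5 h4, h.holds_costsOf two_ne_zero h2 h3,
      h.holds_costsOf two_ne_zero h2 h4, h.holds_costsOf three_ne_zero h3 h2,
      h.holds_costsOf four_ne_zero h4 h2, holds_eq, eval, h3, h4, Fin.ext_iff]
  simp only [key]
  constructor
  · intro H
    exact ⟨fun p hp q hq s hs => (H p q s).1 hp hq hs, fun p hp q hq s hs => (H p q s).2 hp hq hs⟩
  · intro H p q s
    exact ⟨fun hp hq hs => H.1 p hp q hq s hs, fun hp hq hs => H.2 p hp q hq s hs⟩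

/-- Any vertex that can be placed would do; taking the first one leaves a single term in the sum,
whose value is then that vertex. -/
theorem exists_nextVertex (h : Layout G c pos m)
    (hex : ∃ u, pos u = 0 ∧ IsGoodCut (Costs G c) (insert u {u | pos u ≠ 0})) :
    ∃ u : Fin n, nextVertex.eval n ρ m = u ∧ pos u = 0 ∧
      IsGoodCut (Costs G c) (insert u {u | pos u ≠ 0}) := by
  classical
  obtain ⟨u, hu, hmin⟩ := Set.exists_min_image
    {u | pos u = 0 ∧ IsGoodCut (Costs G c) (insert u {u | pos u ≠ 0})} id (Set.toFinite _) hex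
  refine ⟨u, ?_, hu⟩
  have key : ∀ w : Fin n, (and (canPlace 1) (all 5 (imp (lt (var 5) (var 1))
      (not (canPlace 5))))).Holds n (Function.update ρ 1 w) m ↔ w = u := by
    intro w
    simp only [holds_and, holds_all, holds_imp, holds_not, holds_lt]
    rw [h.holds_canPlace (u := w) (.inr rfl) (by simp)]
    have : ∀ z : Fin n, (canPlace 5).Holds n
        (Function.update (Function.update ρ 1 ↑w) 5 ↑z) m ↔ _ :=
      fun z => h.holds_canPlace (u := z) (.inl (by omega)) (by simp)
    simp only [this, eval, Function.update_self, ne_eq, OfNat.one_ne_ofNat, not_false_eq_true,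
      Function.update_of_ne]
    constructor
    · rintro ⟨hw, hw'⟩
      by_contra hne
      have hle : u ≤ w := hmin w hw
      exact hw' u (Fin.lt_def.1 (lt_of_le_of_ne hle (Ne.symm hne))) hu
    · rintro rfl
      exact ⟨hu, fun z hz hz' => absurd (hmin z hz') (by simpa using hz)⟩
  rw [nextVertex, eval, Finset.sum_eq_single u]
  · rw [eval_ite_pos ((key u).2 rfl)]
    simp [eval]
  · intro w _ hne
    rw [eval_ite_neg fun k => hne ((key w).1 k)]
    rfl
  · simp

theorem update_pos (h : Layout G c pos m) (v : Fin n) (k : ℕ) :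
    Layout G c (Function.update pos v k)
      (Function.update m (4 * (n * n + n + 1) + v) k) where
  part i hi := by
    rw [Function.update_of_ne (by simp at hi; omega), h.part i hi]
  adj i hi := by
    rw [Function.update_of_ne (by simp at hi; omega), h.adj i hi]
  pos := stored_ofFn.2 fun i => by
    have := stored_ofFn.1 h.pos i
    by_cases hi : i = v
    · subst hi; simp
    · rw [Function.update_of_ne hi, Function.update_of_ne
        (fun e => hi (Fin.ext (by omega))), this]

/-- Positions that are all `0` describe the empty order. In each round `exists_next` guarantees a
candidate, so the search never falls back on the default value `0`. -/
theorem placeAll (h : Layout G c (fun _ => 0) m) (hG : IsQuasiChain G c) :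
    ∃ pos, Layout G c pos (placeAll.exec n ρ m) ∧ IsPartialOrder (Costs G c) n pos := by
  refine Cmd.exec_loop_induction
    (fun k m' => ∃ pos, Layout G c pos m' ∧ IsPartialOrder (Costs G c) k pos)
    ⟨_, h, .zero _⟩ ?_
  rintro k hk m' ⟨pos, h1, h2⟩
  obtain ⟨u, hu, hu0, hg⟩ := h1.exists_nextVertex (ρ := Function.update ρ 6 k)
    (h2.exists_next hG.isQuasiTournament (by simpa using hk))
  refine ⟨_, ?_, h2.update hu0 hg⟩
  simp only [Cmd.exec, eval, hu, eval_block, Function.update_self]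
  exact h1.update_pos u (k + 1)

end Layout

/-- The input fills block `0` exactly, so all later cells start at `0`; in particular block `4`
starts as the empty order. -/
theorem prepare_layout {n : ℕ} {G : SimpleGraph (Fin n)} {c : Fin n → Bool}
    (hG : IsQuasiChain G c) (ρ : ℕ → ℕ) :
    ∃ pos, Layout G c pos (prepare.exec n ρ fun i => (encodeBipartite G c).getD i 0) ∧
      IsPartialOrder (Costs G c) n pos := by
  set m : ℕ → ℕ := fun i => (encodeBipartite G c).getD i 0 with hm
  have hlen : (encodeBipartite G c).length = n * n + n + 1 := by
    simp [encodeBipartite]; ring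
  have h0 : Stored m 0 (encodeBipartite G c) := fun i hi => by simp [hm, hi]
  have hz : ∀ a, n * n + n + 1 ≤ a → m a = 0 := fun a ha => List.getD_eq_default _ _ (by omega)
  rw [encodeBipartite, ← List.singleton_append, stored_append, stored_append] at h0
  simp only [List.length_singleton, List.length_ofFn, zero_add] at h0
  obtain ⟨-, hc, ha⟩ := h0
  obtain ⟨c1, f1⟩ := exec_fillVec (n := n) (B := 2 * (n * n + n + 1)) (b := block 2)
    (e := load (add (const 1) (var 1))) (ρ := ρ) (m := m) (fun v => bit (c v = true))
    (fun _ _ => eval_block 2) (by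
      intro m' hm' τ i hi
      have := stored_ofFn.1 hc i
      simp only [eval, hi]
      rw [hm' _ (by omega), this])
  set m1 := (fillVec (block 2) (load (add (const 1) (var 1)))).exec n ρ m with hm1
  obtain ⟨c2, f2⟩ := exec_fillMat (n := n) (B := 3 * (n * n + n + 1)) (b := block 3)
    (e := load (add (add (const 1) size) (entry (var 1) (var 2)))) (ρ := ρ) (m := m1) G.Adj
    (fun _ _ => eval_block 3) (by
      intro m' hm' τ i j hi hj
      have := stored_encodeRel.1 ha i j
      have hlt := Fin.mul_add_lt_sq i j
      simp only [eval, entry, Function.update_of_ne one_ne_zero, hi, hj, Finset.sum_const,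
        Finset.card_univ, Fintype.card_fin, smul_eq_mul]
      rw [mul_comm n (i : ℕ), hm' _ (by omega), f1 _ (by omega), this])
  refine Layout.placeAll (G := G) (c := c) (m := (fillMat (block 3) (load (add (add (const 1) size)
    (entry (var 1) (var 2))))).exec n ρ m1) ⟨c1.of_agreeOutside f2 ?_, c2, ?_⟩ hG
  · simp; omega
  · refine stored_ofFn.2 fun i => ?_
    rw [f2 _ (by omega), f1 _ (by omega), hz _ (by omega)]

/-- Find a decomposition. -/
def decompose : Cmd :=
  .seq prepare <|
  .seq (fillMat (const 0) (truth (or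
    (and (partOf (var 1)) (and (not (partOf (var 2))) (lt (posOf (var 1)) (posOf (var 2)))))
    (and (partOf (var 2)) (and (not (partOf (var 1))) (lt (posOf (var 2)) (posOf (var 1)))))))) <|
  fillMat sizeSq (truth (or
    (and (lt (posOf (var 1)) (posOf (var 2))) (costsOf (var 1) (var 2)))
    (and (lt (posOf (var 2)) (posOf (var 1))) (costsOf (var 2) (var 1)))))

theorem decompose_outputsWithin {n : ℕ} {G : SimpleGraph (Fin n)} {c : Fin n → Bool}
    (hG : IsQuasiChain G c) : ∃ Z H : SimpleGraph (Fin n), IsDecomposition G c Z H ∧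
      decompose.program.OutputsWithin (encodeBipartite G c) (encodeDecomposition Z H)
        ((decompose.cost + 1).eval n) := by
  obtain ⟨pos, hl, hp⟩ := prepare_layout hG fun _ => 0
  have ho : IsWordOrder (Costs G c) pos := IsPartialOrder.isWordOrder (by simpa using hp)
  refine ⟨_, _, ho.isDecomposition hG.1, Cmd.program_outputsWithin _ ?_⟩
  rw [← encodeBipartite]
  simp only [decompose, Cmd.exec]
  set m := prepare.exec n (fun _ => 0) fun i => (encodeBipartite G c).getD i 0
  obtain ⟨c1, f1⟩ := exec_fillMat (n := n) (B := 0) (b := const 0) (e := truth (or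
    (and (partOf (var 1)) (and (not (partOf (var 2))) (lt (posOf (var 1)) (posOf (var 2)))))
    (and (partOf (var 2)) (and (not (partOf (var 1))) (lt (posOf (var 2)) (posOf (var 1)))))))
    (ρ := fun _ => 0) (m := m) (chainOf c pos).Adj
    (fun _ _ => rfl) (by
      intro m' hm' τ i j hi hj
      have hl' := hl.of_agree (m' := m') fun a ha => hm' a (by omega)
      rw [eval_truth, holds_or, holds_and, holds_and, holds_and, holds_and, holds_not, holds_not,
        holds_lt, holds_lt, hl'.eval_posOf (a := var 1) hi, hl'.eval_posOf (a := var 2) hj,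
        hl'.holds_partOf (a := var 1) hi, hl'.holds_partOf (a := var 2) hj]
      congr 1
      cases hi : c i <;> cases hj : c j <;> simp [chainOf, hi, hj])
  set m1 := (fillMat (const 0) _).exec n (fun _ => 0) m
  -- The second matrix consists of the forward arcs, by `symmDiff_chainOf_adj`; it starts in cell `n
  -- * n`, right after the first.
  obtain ⟨c2, f2⟩ := exec_fillMat (n := n) (B := n * n) (b := sizeSq) (e := truth (or
    (and (lt (posOf (var 1)) (posOf (var 2))) (costsOf (var 1) (var 2)))
    (and (lt (posOf (var 2)) (posOf (var 1))) (costsOf (var 2) (var 1)))))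
    (ρ := fun _ => 0) (m := m1) (G ∆ chainOf c pos).Adj
    (fun _ _ => eval_sizeSq) (by
      intro m' hm' τ i j hi hj
      have hl' := hl.of_agree (m' := m') fun a ha =>
        (hm' a (by omega)).trans (f1 a (by omega))
      rw [eval_truth, holds_or, holds_and, holds_and, holds_lt, holds_lt,
        hl'.eval_posOf (a := var 1) hi, hl'.eval_posOf (a := var 2) hj,
        hl'.holds_costsOf one_ne_zero hi hj, hl'.holds_costsOf two_ne_zero hj hi]
      congr 1
      exact propext (hG.1.symmDiff_chainOf_adj ho.inj).symm)
  have := stored_append.2 ⟨c1.of_agreeOutside f2 (.inl (by simp)), by simpa using c2⟩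
  intro i hi
  have h := this i hi
  rwa [zero_add] at h

/-- The vertex in position `x`; the variable `y` is used in the search. -/
def vertexAt (x y : ℕ) : Expr :=
  sum y (ite (eq (posOf (var y)) (add (var x) (const 1))) (var y) (const 0))

/-- Word positions count from zero and `pos` from one, hence the shift. Injectivity of `pos` leaves
one term in the sum. -/
theorem Layout.eval_vertexAt {n : ℕ} {G : SimpleGraph (Fin n)} {c : Fin n → Bool}
    {pos : Fin n → ℕ} {ρ m : ℕ → ℕ} (h : Layout G c pos m) (hpos : Function.Injective pos)
    {σ : Fin n ≃ Fin n} (hσ : ∀ k, pos (σ k) = k + 1) {x y : ℕ} (hxy : x ≠ y) {k : Fin n}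
    (hx : ρ x = k) : (vertexAt x y).eval n ρ m = σ k := by
  have key : ∀ w : Fin n, (eq (posOf (var y)) (add (var x) (const 1))).Holds n
      (Function.update ρ y w) m ↔ w = σ k := by
    intro w
    rw [holds_eq, h.eval_posOf (u := w) (by simp [eval])]
    simp only [eval, Function.update_of_ne hxy, hx, ← hσ]
    exact hpos.eq_iff
  rw [vertexAt, eval, Finset.sum_eq_single (σ k)]
  · rw [eval_ite_pos ((key _).2 rfl)]
    simp [eval]
  · intro w _ hne
    rw [eval_ite_neg fun e => hne ((key w).1 e)]
    rfl
  · simp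

/-- The vertices in positions `x₁`, `x₂` are in `A` and in `B`, respectively. -/
def isPair : Expr := and (partOf (vertexAt 1 3)) (not (partOf (vertexAt 2 3)))

/-- Find an enhanced letter representation. -/
def represent : Cmd :=
  .seq prepare <|
  .seq (fillVec (const 0) (vertexAt 1 3)) <|
  .seq (fillVec size (truth (partOf (vertexAt 1 3)))) <|
  .seq (fillMat (add size size) (truth (and isPair
    (and (lt (var 1) (var 2)) (not (adjOf (vertexAt 1 3) (vertexAt 2 3))))))) <|
  fillMat (add (add size size) sizeSq) (truth (and isPair
    (and (lt (var 2) (var 1)) (adjOf (vertexAt 1 3) (vertexAt 2 3)))))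

/-- The output takes `2 * n + 2 * n * n` cells, fewer than two blocks, so the layout survives each
of the four writes and can be read throughout. -/
theorem represent_outputsWithin {n : ℕ} {G : SimpleGraph (Fin n)} {c : Fin n → Bool}
    (hG : IsQuasiChain G c) : ∃ (w : EnhancedWord n) (σ : Fin n ≃ Fin n), w.Represents σ G c ∧
      represent.program.OutputsWithin (encodeBipartite G c) (encodeRepresentation w σ)
        ((represent.cost + 1).eval n) := by
  obtain ⟨pos, hl, hp⟩ := prepare_layout hG fun _ => 0
  have ho : IsWordOrder (Costs G c) pos := IsPartialOrder.isWordOrder (by simpa using hp)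
  obtain ⟨σ, hσ⟩ := hp.exists_equiv
  refine ⟨_, σ, ho.word_represents hG.1 σ hσ, Cmd.program_outputsWithin _ ?_⟩
  rw [← encodeBipartite]
  simp only [represent, Cmd.exec]
  set m := prepare.exec n (fun _ => 0) fun i => (encodeBipartite G c).getD i 0
  obtain ⟨c1, f1⟩ := exec_fillVec (n := n) (B := 0) (b := const 0) (e := vertexAt 1 3)
    (ρ := fun _ => 0) (m := m) (fun k => (σ k : ℕ)) (fun _ _ => rfl) (by
      intro m' hm' τ i hi
      have hl' := hl.of_agree (m' := m') fun a ha => hm' a (by omega)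
      exact hl'.eval_vertexAt ho.inj hσ (by decide) hi)
  set m1 := (fillVec (const 0) _).exec n (fun _ => 0) m
  have hl1 := hl.of_agree (m' := m1) fun a ha => f1 a (by omega)
  obtain ⟨c2, f2⟩ := exec_fillVec (n := n) (B := n) (b := size)
    (e := truth (partOf (vertexAt 1 3))) (ρ := fun _ => 0) (m := m1)
    (fun k => bit ((ho.word σ hσ).letter k = true)) (fun _ _ => rfl) (by
      intro m' hm' τ i hi
      have hl' := hl1.of_agree (m' := m') fun a ha => hm' a (by omega)
      rw [eval_truth, hl'.holds_partOf (hl'.eval_vertexAt ho.inj hσ (by decide) hi)]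
      rfl)
  set m2 := (fillVec size _).exec n (fun _ => 0) m1
  have hl2 := hl1.of_agree (m' := m2) fun a ha => f2 a (by omega)
  have hadj : ∀ m', Layout G c pos m' → ∀ (τ : ℕ → ℕ) (i j : Fin n), τ 1 = i → τ 2 = j →
      ((adjOf (vertexAt 1 3) (vertexAt 2 3)).Holds n τ m' ↔ G.Adj (σ i) (σ j)) :=
    fun m' hl' τ i j hi hj => hl'.holds_adjOf
      (fun k => hl'.eval_vertexAt ho.inj hσ (by decide) (by simpa using hi))
      (hl'.eval_vertexAt ho.inj hσ (by decide) hj)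
  have hpair : ∀ m', Layout G c pos m' → ∀ (τ : ℕ → ℕ) (i j : Fin n), τ 1 = i → τ 2 = j →
      (isPair.Holds n τ m' ↔ c (σ i) = true ∧ c (σ j) = false) := by
    intro m' hl' τ i j hi hj
    rw [isPair, holds_and, holds_not,
      hl'.holds_partOf (hl'.eval_vertexAt ho.inj hσ (by decide) hi),
      hl'.holds_partOf (hl'.eval_vertexAt ho.inj hσ (by decide) hj), Bool.not_eq_true]
  obtain ⟨c3, f3⟩ := exec_fillMat (n := n) (B := n + n) (b := add size size)
    (e := truth (and isPair
      (and (lt (var 1) (var 2)) (not (adjOf (vertexAt 1 3) (vertexAt 2 3))))))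
    (ρ := fun _ => 0) (m := m2) (ho.word σ hσ).bottom (fun _ _ => rfl) (by
      intro m' hm' τ i j hi hj
      have hl' := hl2.of_agree (m' := m') fun a ha => hm' a (by omega)
      rw [eval_truth, holds_and, holds_and, holds_not, holds_lt, hadj m' hl' τ i j hi hj,
        hpair m' hl' τ i j hi hj]
      simp [eval, hi, hj, IsWordOrder.word, and_assoc])
  set m3 := (fillMat (add size size) _).exec n (fun _ => 0) m2
  have hl3 := hl2.of_agree (m' := m3) fun a ha => f3 a (by omega)
  obtain ⟨c4, f4⟩ := exec_fillMat (n := n) (B := n + n + n * n) (b := add (add size size) sizeSq)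
    (e := truth (and isPair
      (and (lt (var 2) (var 1)) (adjOf (vertexAt 1 3) (vertexAt 2 3)))))
    (ρ := fun _ => 0) (m := m3) (ho.word σ hσ).top (fun _ _ => by simp [eval]) (by
      intro m' hm' τ i j hi hj
      have hl' := hl3.of_agree (m' := m') fun a ha => hm' a (by omega)
      rw [eval_truth, holds_and, holds_and, holds_lt, hadj m' hl' τ i j hi hj,
        hpair m' hl' τ i j hi hj]
      simp [eval, hi, hj, IsWordOrder.word, and_assoc])
  have s1 := ((c1.of_agreeOutside f2 (.inl (by simp))).of_agreeOutside f3
    (.inl (by simp))).of_agreeOutside f4 (.inl (by simp; omega))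
  have s2 := (c2.of_agreeOutside f3 (.inl (by simp))).of_agreeOutside f4 (.inl (by simp))
  have s3 := c3.of_agreeOutside f4 (.inl (by simp))
  have := stored_append.2 ⟨stored_append.2 ⟨stored_append.2 ⟨s1, by simpa using s2⟩,
    by simpa using s3⟩, by simpa [add_assoc] using c4⟩
  intro i hi
  have h := this i hi
  rwa [zero_add] at h

end QuasiChain

theorem theorem4p1 :
    -- every finite quasi-chain graph has a decomposition
    (∀ {V : Type*} [Finite V] (G : SimpleGraph V) (c : V → Bool),
      QuasiChain.IsQuasiChain G c →
        ∃ Z H : SimpleGraph V, QuasiChain.IsDecomposition G c Z H) ∧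
    -- such a decomposition can be obtained in polynomial time
    (∃ (P : QuasiChain.RamProg) (p : Polynomial ℕ),
      ∀ (n : ℕ) (G : SimpleGraph (Fin n)) (c : Fin n → Bool),
        QuasiChain.IsQuasiChain G c →
          ∃ Z H : SimpleGraph (Fin n), QuasiChain.IsDecomposition G c Z H ∧
            P.OutputsWithin (QuasiChain.encodeBipartite G c)
              (QuasiChain.encodeDecomposition Z H) (p.eval n)) ∧
    -- an enhanced letter representation can be found in polynomial time
    (∃ (P : QuasiChain.RamProg) (p : Polynomial ℕ),
      ∀ (n : ℕ) (G : SimpleGraph (Fin n)) (c : Fin n → Bool),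
        QuasiChain.IsQuasiChain G c →
          ∃ (w : QuasiChain.EnhancedWord n) (σ : Fin n ≃ Fin n), w.Represents σ G c ∧
            P.OutputsWithin (QuasiChain.encodeBipartite G c)
              (QuasiChain.encodeRepresentation w σ) (p.eval n)) := by
  refine ⟨fun {V} _ G c hG => ?_,
    ⟨_, _, fun n G c hG => QuasiChain.decompose_outputsWithin hG⟩,
    ⟨_, _, fun n G c hG => QuasiChain.represent_outputsWithin hG⟩⟩
  have := Fintype.ofFinite V
  obtain ⟨pos, hp⟩ := QuasiChain.IsPartialOrder.exists_of_le_card hG.isQuasiTournament _ le_rfl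
  exact ⟨_, _, hp.isWordOrder.isDecomposition hG.1⟩
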